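/- **Lemma.** Let $N,k\ge 0$ be integers. All $\mathcal O(\cdot)$ refer to $h\to 0^+$. *Setting for (a), (b).* Let $a<b$. Let $(\mathcal L_h)_{h>0}$ be a family of smooth Lagrangians $\mathcal L_h[x]=\mathcal L_h(x,\dot x,\dots,x^{(n)})$ on $(\mathbb R^N)^{n+1}$, with $n$ independent of $h$, all of whose partial derivatives are bounded on compact sets uniformly for small $h$ (for instance a truncated power series in $h$ with smooth coefficients). Let $S_h(x)=\int_a^b\mathcal L_h[x(t)]\,dt$ and $\frac{\delta\mathcal L_h}{\delta x}=\sum_{i\ge 0}(-1)^i\frac{d^i}{dt^i}\frac{\partial\mathcal L_h}{\partial x^{(i)}}$; these expressions are evaluated along $x_h$, and $\delta S_h=\frac{d}{d\varepsilon}\big|_{\varepsilon=0}S_h(x_h+\varepsilon\,\delta x_h)$. Norms $\|\cdot\|_\infty$, $\|\cdot\|_1$ are over $[a,b]$. A family $(x_h)_{h>0}$ of smooth curves $x_h:[a,b]\to\mathbb R^N$ is *admissible* if there is $h_{\max}>0$ such that for every $m\ge 0$ the norm $\|x_h^{(m)}\|_\infty$ is bounded for $h\in(0,h_{\max}]$.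 All variations are required to vanish at $a$ and $b$ together with all their derivatives. An admissible family $(x_h)$ is *$k$-critical* if $\delta S_h=\mathcal O(h^{k+1}\|\delta x_h\|_1)$ for every family $(\delta x_h)$ of smooth variations. It is *meshed $k$-critical* if $\delta S_h=\mathcal O(h^{k+1}\|\delta x_h\|_1)$ for every family $(\delta x_h)$ of variations such that: $\delta x_h$ is continuous and is smooth outside a mesh $t_0+h\mathbb N$, where $t_0\in[a,b]$ may depend on $h$; each derivative of $\delta x_h$ is bounded (off the nonsmooth points) uniformly for small $h$; and $h^m=\mathcal O(\|\delta x_h\|_1)$ for some $m\in\mathbb N$. (a) An admissible family $(x_h)$ is $k$-critical if and only if $$\Big\|\frac{\delta\mathcal L_h}{\delta x}\Big\|_\infty=\mathcal O(h^{k+1}).$$ (b) An admissible family $(x_h)$ is meshed $k$-critical if and only if $$\Big\|\frac{\delta\mathcal L_h}{\delta x}\Big\|_\infty=\mathcal O(h^{k+1})\quad\text{and}\quad \Big\|\frac{\partial\mathcal L_h}{\partial x^{(\ell)}}\Big\|_\infty=\mathcal O(h^{k+\ell+1})\ \text{ for all }\ell\ge 2.$$ (c) Let $L_{\mathrm{disc}}:\mathbb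 R^N\times\mathbb R^N\times\mathbb R_{>0}\to\mathbb R$ be differentiable in its first two arguments jointly, for each $h$. For each $h>0$ let $(x_0,\dots,x_n)$ be a discrete curve in $\mathbb R^N$ (both $n$ and the $x_j$ may depend on $h$), and let $S_{\mathrm{disc}}=\sum_{j=1}^{n}h\,L_{\mathrm{disc}}(x_{j-1},x_j,h)$. The family is called *$k$-critical* if $\delta S_{\mathrm{disc}}=\mathcal O\big(h^{k+1}\sum_{j=0}^n h|\delta x_j|\big)$ for every family of variations with $\delta x_0=\delta x_n=0$. It is $k$-critical if and only if, uniformly in $1\le j\le n-1$, $$\mathrm D_2L_{\mathrm{disc}}(x_{j-1},x_j,h)+\mathrm D_1L_{\mathrm{disc}}(x_j,x_{j+1},h)=\mathcal O(h^{k+1}).$$ -/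

import Mathlib

open Set Filter Topology Asymptotics
open scoped ContDiff

noncomputable section

namespace KCrit

/-- The configuration space `ℝ^N` with its Euclidean norm. -/
abbrev Conf (N : ℕ) : Type := EuclideanSpace ℝ (Fin N)

/-- Points `(x, x', …, x^(n))` of the jet space of order `n`. -/
abbrev Jet (N n : ℕ) : Type := Fin (n + 1) → Conf N

variable {N n : ℕ}

/-- The jet `[x](t) = (x(t), x'(t), …, x^(n)(t))` of a curve `x : [a,b] → ℝ^N`
(one-sided derivatives at `a` and `b`). -/
def jet (n : ℕ) (a b : ℝ) (x : ℝ → Conf N) (t : ℝ) : Jet N n :=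
  fun i => iteratedDerivWithin (i : ℕ) x (Icc a b) t

/-- A family `(L_h)_{h > 0}` of smooth Lagrangians depending on `x` and its derivatives up to
order `n`, all of whose partial derivatives are bounded on compact sets uniformly as `h → 0`.
Truncated power series `L_h = ∑_{i ≤ m} h^i F_i` with smooth coefficients `F_i` are of this kind. -/
structure IsLagrangianFamily (L : ℝ → Jet N n → ℝ) : Prop where
  smooth : ∀ h : ℝ, 0 < h → ContDiff ℝ ∞ (L h)
  bounded : ∃ hmax : ℝ, 0 < hmax ∧ ∀ (m : ℕ) (K : Set (Jet N n)), IsCompact K →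
    ∃ C : ℝ, ∀ h ∈ Ioc 0 hmax, ∀ u ∈ K, ‖iteratedFDeriv ℝ m (L h) u‖ ≤ C

/-- Admissible families of smooth curves `x_h : [a,b] → ℝ^N`. -/
structure IsAdmissible (a b : ℝ) (x : ℝ → ℝ → Conf N) : Prop where
  smooth : ∀ h : ℝ, 0 < h → ContDiffOn ℝ ∞ (x h) (Icc a b)
  bounded : ∃ hmax : ℝ, 0 < hmax ∧ ∀ m : ℕ, ∃ C : ℝ, ∀ h ∈ Ioc 0 hmax, ∀ t ∈ Icc a b,
    ‖iteratedDerivWithin m (x h) (Icc a b) t‖ ≤ C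

/-- The action `∫_a^b L[x(t)] dt`. -/
def action (a b : ℝ) (L : Jet N n → ℝ) (x : ℝ → Conf N) : ℝ :=
  ∫ t in a..b, L (jet n a b x t)

/-- The first variation `δS = d/dε S(x + ε δx)` at `ε = 0`. -/
def firstVariation (a b : ℝ) (L : Jet N n → ℝ) (x δx : ℝ → Conf N) : ℝ :=
  deriv (fun ε : ℝ => action a b L (fun t => x t + ε • δx t)) 0

/-- The norm `‖y‖₁` on `[a,b]`. -/
def norm1 (a b : ℝ) (y : ℝ → Conf N) : ℝ := ∫ t in a..b, ‖y t‖

/-- Smooth variations on `[a,b]` respecting a full set of boundary conditions, that is, all of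
`δx, δx', δx'', …` vanish at `a` and at `b`. Equivalently, the extension of `δx` by zero is
smooth on `ℝ`; variations are represented by this extension. -/
structure IsSmoothVariation (a b : ℝ) (y : ℝ → Conf N) : Prop where
  smooth : ContDiff ℝ ∞ y
  zero_outside : ∀ t, t ∉ Icc a b → y t = 0

/-- Piecewise smooth variations on `[a,b]` whose nonsmooth points lie in a mesh `t₀ + hℕ`
with `t₀ ∈ [a,b]`, again respecting a full set of boundary conditions and extended by zero. -/
structure IsMeshedVariation (a b h : ℝ) (y : ℝ → Conf N) : Prop where
  continuous : Continuous y
  zero_outside : ∀ t, t ∉ Icc a b → y t = 0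
  smooth_off_mesh : ∃ t₀ ∈ Icc a b, ∀ t : ℝ,
    (t ∈ Ioo a b ∧ ∃ j : ℕ, t - t₀ = j * h) ∨ ContDiffAt ℝ ∞ y t

/-- The families of variations allowed in the meshed problem: `δx_h` is piecewise smooth with
mesh size `h`, all derivatives are bounded as `h → 0` (off the nonsmooth points), and the family
is of finite order in `h`, that is, `‖δx_h‖₁` is not smaller than every power of `h`. -/
structure IsMeshedVariationFamily (a b : ℝ) (δx : ℝ → ℝ → Conf N) : Prop where
  meshed : ∀ h : ℝ, 0 < h → IsMeshedVariation a b h (δx h)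
  admissible : ∃ hmax : ℝ, 0 < hmax ∧ ∀ m : ℕ, ∃ C : ℝ, ∀ h ∈ Ioc 0 hmax, ∀ t ∈ Icc a b,
    ContDiffAt ℝ ∞ (δx h) t → ‖iteratedDeriv m (δx h) t‖ ≤ C
  finite_order : ∃ m : ℕ,
    (fun h : ℝ => h ^ m) =O[𝓝[>] 0] (fun h : ℝ => norm1 a b (δx h))

/-- `k`-criticality: `δS_h = O(h^(k+1) ‖δx_h‖₁)` for every family of smooth variations. -/
def IsKCritical (a b : ℝ) (L : ℝ → Jet N n → ℝ) (k : ℕ) (x : ℝ → ℝ → Conf N) : Prop :=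
  ∀ δx : ℝ → ℝ → Conf N, (∀ h : ℝ, 0 < h → IsSmoothVariation a b (δx h)) →
    (fun h : ℝ => firstVariation a b (L h) (x h) (δx h))
      =O[𝓝[>] 0] (fun h : ℝ => h ^ (k + 1) * norm1 a b (δx h))

/-- Meshed `k`-criticality: `δS_h = O(h^(k+1) ‖δx_h‖₁)` for every allowed family of piecewise
smooth variations with nonsmooth points in a mesh of size `h`. -/
def IsMeshedKCritical (a b : ℝ) (L : ℝ → Jet N n → ℝ) (k : ℕ) (x : ℝ → ℝ → Conf N) : Prop :=
  ∀ δx : ℝ → ℝ → Conf N, IsMeshedVariationFamily a b δx →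
    (fun h : ℝ => firstVariation a b (L h) (x h) (δx h))
      =O[𝓝[>] 0] (fun h : ℝ => h ^ (k + 1) * norm1 a b (δx h))

/-- The partial derivative `∂L/∂x^(i)` as a covector; it is zero for `i > n`. -/
def partialL (L : Jet N n → ℝ) (i : ℕ) (u : Jet N n) : Conf N →L[ℝ] ℝ :=
  if hi : i < n + 1 then
    (fderiv ℝ L u).comp (ContinuousLinearMap.single ℝ (fun _ : Fin (n + 1) => Conf N) ⟨i, hi⟩)
  else 0

/-- The function `t ↦ ∂L/∂x^(i) [x(t)]`. -/
def partialAlong (a b : ℝ) (L : Jet N n → ℝ) (x : ℝ → Conf N) (i : ℕ) (t : ℝ) :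
    Conf N →L[ℝ] ℝ :=
  partialL L i (jet n a b x t)

/-- The Euler-Lagrange expression `δL/δx = ∑_i (-1)^i d^i/dt^i (∂L/∂x^(i))` along `x`. -/
def eulerLagrange (a b : ℝ) (L : Jet N n → ℝ) (x : ℝ → Conf N) (t : ℝ) : Conf N →L[ℝ] ℝ :=
  ∑ i ∈ Finset.range (n + 1),
    (-1 : ℝ) ^ i • iteratedDerivWithin i (partialAlong a b L x i) (Icc a b) t

/-- `‖f_h‖_∞ = O(h^p)` as `h → 0`, with the supremum norm over `[a,b]`. -/
def UniformBigO (a b : ℝ) (f : ℝ → ℝ → (Conf N →L[ℝ] ℝ)) (p : ℕ) : Prop :=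
  ∃ C : ℝ, ∀ᶠ h : ℝ in 𝓝[>] 0, ∀ t ∈ Icc a b, ‖f h t‖ ≤ C * h ^ p

/-- The discrete action `∑_{j=1}^n h L(x_{j-1}, x_j, h)` of a discrete curve `(x_0, …, x_n)`. -/
def discAction (L : Conf N → Conf N → ℝ → ℝ) (h : ℝ) (n : ℕ) (x : ℕ → Conf N) : ℝ :=
  ∑ j ∈ Finset.range n, h * L (x j) (x (j + 1)) h

/-- The first variation of the discrete action. -/
def discFirstVariation (L : Conf N → Conf N → ℝ → ℝ) (h : ℝ) (n : ℕ) (x δx : ℕ → Conf N) : ℝ :=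
  deriv (fun ε : ℝ => discAction L h n (fun j => x j + ε • δx j)) 0

/-- The norm `∑_j h |δx_j|` of a variation `(δx_0, …, δx_n)`. -/
def discNorm (h : ℝ) (n : ℕ) (δx : ℕ → Conf N) : ℝ :=
  ∑ j ∈ Finset.range (n + 1), h * ‖δx j‖

/-- `k`-criticality of a family of discrete curves `(x_0, …, x_n)`, `n = n_h`, with respect to
variations that vanish at both endpoints. -/
def IsDiscKCritical (L : Conf N → Conf N → ℝ → ℝ) (k : ℕ) (n : ℝ → ℕ) (x : ℝ → ℕ → Conf N) :
    Prop :=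
  ∀ δx : ℝ → ℕ → Conf N, (∀ h : ℝ, 0 < h → δx h 0 = 0 ∧ δx h (n h) = 0) →
    (fun h : ℝ => discFirstVariation L h (n h) (x h) (δx h))
      =O[𝓝[>] 0] (fun h : ℝ => h ^ (k + 1) * discNorm h (n h) (δx h))

/-- The discrete Euler-Lagrange expression `D₂L(u, v, h) + D₁L(v, w, h)`. -/
def discEulerLagrange (L : Conf N → Conf N → ℝ → ℝ) (h : ℝ) (u v w : Conf N) :
    Conf N →L[ℝ] ℝ :=
  fderiv ℝ (fun q => L u q h) v + fderiv ℝ (fun q => L q w h) v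

end KCrit

end

/-! For smooth variations, integration by parts turns `δS_h` into the integral of the Euler-Lagrange
expression against `δx`. Part (a) is then the duality between the sup norm and `‖·‖₁`: a bump placed
where that expression is nearly maximal recovers its norm up to a factor 2. In (c), summation by
parts and a variation supported at a single index play the same roles.

In (b) the variation may have kinks. Then `δS_h` is the Euler-Lagrange integral plus one
`partsError` for each order `i`, which collects the boundary terms of `i` integrations by parts. It
vanishes for `i < 2` because variations are continuous. For `i ≥ 2` two estimates at scale `h`
control it. The inverse estimate `IsMeshedVariationFamily.integral_norm_deriv_le` gives `‖δx^(i)‖₁ =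
O(h^(-i) ‖δx‖₁)`: on a mesh-free segment of length `h / 4` the variation is a polynomial up to a
Taylor remainder that the finite-order condition absorbs. The interpolation estimate
`exists_bound_deriv_of_interior` says that `j` derivatives of an `O(h^p)` function with bounded
derivatives cost at most `h^(-j)`. Both rest on `exists_density_deriv`, which reads off a Taylor
coefficient by integrating against a fixed polynomial.

Necessity in (b) uses the variations `h^(deg P) P((t - s) / h) v` on `[s, s + h]`; the prefactor
keeps every derivative bounded. For the Euler-Lagrange expression, `P` vanishes to high order at
both ends and has moments `1, 0, …, 0`, so the integral returns the value at `s` up to `O(h^(k+1))`.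
For `∂L/∂x^(ℓ)`, descending induction on `ℓ` is used with `P = X^(ℓ-1) (1 - X)^ℓ`: orders below `ℓ`
leave no boundary term, order `ℓ` leaves exactly one, and higher orders are already known to be
small. -/

noncomputable section

namespace KCrit

/-! ### Taylor polynomials, reproducing densities and interpolation on an interval -/

section Tower

open MeasureTheory Polynomial

variable {E F : Type} [NormedAddCommGroup E] [NormedSpace ℝ E] [NormedAddCommGroup F]
  [NormedSpace ℝ F]

/-- A sequence of functions on `S`, each of which is the derivative of the preceding one. -/
def IsTower (S : Set ℝ) (f : ℕ → ℝ → E) : Prop :=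
  ∀ j, ∀ t ∈ S, HasDerivWithinAt (f j) (f (j + 1) t) S t

theorem IsTower.shift {S : Set ℝ} {f : ℕ → ℝ → E} (hf : IsTower S f) (i : ℕ) :
    IsTower S (fun j => f (j + i)) := by
  intro j t ht
  have := hf (j + i) t ht
  rwa [show j + i + 1 = j + 1 + i by ring] at this

theorem IsTower.mono {S T : Set ℝ} {f : ℕ → ℝ → E} (hf : IsTower S f) (h : T ⊆ S) :
    IsTower T f :=
  fun j t ht => (hf j t (h ht)).mono h

theorem IsTower.continuousOn {S : Set ℝ} {f : ℕ → ℝ → E} (hf : IsTower S f) (j : ℕ) :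
    ContinuousOn (f j) S :=
  fun t ht => (hf j t ht).continuousWithinAt

theorem IsTower.clm_comp {S : Set ℝ} {f : ℕ → ℝ → E} (hf : IsTower S f) (A : E →L[ℝ] F) :
    IsTower S (fun j t => A (f j t)) :=
  fun j t ht => A.hasFDerivAt.comp_hasDerivWithinAt t (hf j t ht)

theorem IsTower.comp_affine {S T : Set ℝ} {f : ℕ → ℝ → E} (hf : IsTower S f) (c d : ℝ)
    (h : MapsTo (fun t => d + c * t) T S) :
    IsTower T (fun j t => c ^ j • f j (d + c * t)) := by
  intro j t ht
  have h1 : HasDerivWithinAt (fun t => d + c * t) c T t := by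
    simpa using ((hasDerivAt_id t).const_mul c).const_add d |>.hasDerivWithinAt
  have h2 := ((hf j _ (h ht)).scomp t h1 h).const_smul (c ^ j)
  rw [smul_smul, ← pow_succ] at h2
  exact h2

theorem IsTower.iteratedDerivWithin_eq {S : Set ℝ} (hS : UniqueDiffOn ℝ S) {f : ℕ → ℝ → E}
    (hf : IsTower S f) (j : ℕ) {t : ℝ} (ht : t ∈ S) : iteratedDerivWithin j (f 0) S t = f j t := by
  induction j generalizing t with
  | zero => simp
  | succ j ih =>
    rw [iteratedDerivWithin_succ, derivWithin_congr (fun s hs => ih hs) (ih ht)]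
    exact (hf j t ht).derivWithin (hS t ht)

theorem isTower_iteratedDerivWithin {S : Set ℝ} (hS : UniqueDiffOn ℝ S) {f : ℝ → E}
    (hf : ContDiffOn ℝ ∞ f S) : IsTower S (fun j => iteratedDerivWithin j f S) := by
  intro j t ht
  have h1 : DifferentiableOn ℝ (iteratedDerivWithin j f S) S :=
    hf.differentiableOn_iteratedDerivWithin (by exact_mod_cast ENat.natCast_lt_top j) hS
  have := (h1 t ht).hasDerivWithinAt
  rwa [← iteratedDerivWithin_succ] at this

/-- The derivative of a Taylor remainder is the remainder of the shifted tower, so induction on `M`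
and the mean value inequality on `[0, 1]` suffice. The usual factor `1 / M!` is not needed later. -/
theorem IsTower.norm_sub_taylor_le {g : ℕ → ℝ → E} (hg : IsTower (Icc 0 1) g) (M : ℕ) {B : ℝ}
    (hB : ∀ s ∈ Icc (0 : ℝ) 1, ‖g M s‖ ≤ B) :
    ∀ s ∈ Icc (0 : ℝ) 1,
      ‖g 0 s - ∑ j ∈ Finset.range M, (s ^ j / (j.factorial : ℝ)) • g j 0‖ ≤ B := by
  induction M generalizing g with
  | zero => simpa using hB
  | succ M ih =>
    intro s hs
    have h0 : (0 : ℝ) ∈ Icc (0 : ℝ) 1 := by simp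
    have hB0 : 0 ≤ B := (norm_nonneg _).trans (hB 0 h0)
    have h1 := ih (hg.shift 1) hB
    have h2 : ∀ s ∈ Icc (0 : ℝ) 1, HasDerivWithinAt
        (fun s => g 0 s - ∑ j ∈ Finset.range (M + 1), (s ^ j / (j.factorial : ℝ)) • g j 0)
        (g 1 s - ∑ j ∈ Finset.range M, (s ^ j / (j.factorial : ℝ)) • g (j + 1) 0)
        (Icc 0 1) s := by
      intro s hs
      refine (hg 0 s hs).sub ?_
      simp_rw [Finset.sum_range_succ']
      have h3 : HasDerivWithinAt (fun s : ℝ => ∑ j ∈ Finset.range M,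
          (s ^ (j + 1) / ((j + 1).factorial : ℝ)) • g (j + 1) 0)
          (∑ j ∈ Finset.range M, (s ^ j / (j.factorial : ℝ)) • g (j + 1) 0) (Icc 0 1) s := by
        refine HasDerivWithinAt.fun_sum fun j _ => ?_
        have h4 := ((hasDerivAt_pow (j + 1) s).div_const ((j + 1).factorial : ℝ)).hasDerivWithinAt
          (s := Icc 0 1)
        have h5 := h4.smul_const (g (j + 1) 0)
        convert h5 using 2
        rw [Nat.factorial_succ]
        have : (j.factorial : ℝ) ≠ 0 := by positivity
        push_cast
        field_simp
      simpa using h3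
    have h6 := (convex_Icc (0 : ℝ) 1).norm_image_sub_le_of_norm_hasDerivWithin_le h2 h1 h0 hs
    have h7 : (g 0 0 - ∑ j ∈ Finset.range (M + 1), ((0 : ℝ) ^ j / (j.factorial : ℝ)) • g j 0) = 0 := by
      simp [Finset.sum_range_succ']
    rw [h7, sub_zero] at h6
    refine h6.trans ?_
    rw [sub_zero, Real.norm_eq_abs, abs_of_nonneg hs.1]
    exact mul_le_of_le_one_right hB0 hs.2

/-- Every linear functional on polynomials of degree `< M` is represented on `[α, β]` by a
polynomial density that vanishes to order `n` at both endpoints. -/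
theorem exists_polynomial_density {α β : ℝ} (hαβ : α < β) (n M : ℕ) (c : ℕ → ℝ) :
    ∃ W : ℝ[X], (X - C α) ^ n * (C β - X) ^ n ∣ W ∧
      ∀ i < M, ∫ s in α..β, W.eval s * s ^ i = c i := by
  classical
  set w : ℝ[X] := (X - C α) ^ n * (C β - X) ^ n with hw
  have hint : ∀ p : ℝ[X], IntervalIntegrable (fun s => p.eval s) volume α β :=
    fun p => p.continuous.intervalIntegrable _ _
  let P : (Fin M → ℝ) → ℝ[X] := fun d => ∑ j, C (d j) * X ^ (j : ℕ)
  -- `T` is the Gram map of the monomials for the weight `w`. It is injective since `∫ w P² = 0`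
  -- with `w > 0` inside forces `P = 0`, hence surjective by dimension: any prescribed moments are
  -- attained by a density `w * P`.
  let T : (Fin M → ℝ) →ₗ[ℝ] (Fin M → ℝ) :=
    { toFun := fun d i => ∫ s in α..β, (w * P d * X ^ (i : ℕ)).eval s
      map_add' := by
        intro d e
        ext i
        rw [Pi.add_apply, ← intervalIntegral.integral_add (hint _) (hint _)]
        congr 1
        ext s
        simp only [P, ← eval_add]
        congr 1
        simp [add_mul, Finset.sum_add_distrib, mul_add]
      map_smul' := by
        intro r d
        ext i
        rw [RingHom.id_apply, Pi.smul_apply, smul_eq_mul, ← intervalIntegral.integral_const_mul]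
        congr 1
        ext s
        simp only [P, eval_mul, eval_finsetSum, Pi.smul_apply, smul_eq_mul, eval_C, eval_pow,
          eval_X, Finset.mul_sum, Finset.sum_mul]
        exact Finset.sum_congr rfl fun j _ => by ring }
  have hT : Function.Injective T := by
    rw [injective_iff_map_eq_zero]
    intro d hd
    have h1 : ∫ s in α..β, (w * P d * P d).eval s = 0 := by
      have h2 : ∀ s, (w * P d * P d).eval s = ∑ i, d i * (w * P d * X ^ (i : ℕ)).eval s := by
        intro s
        conv_lhs => rw [eval_mul]
        conv_lhs => enter [2]; simp only [P]
        rw [eval_finsetSum, Finset.mul_sum]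
        refine Finset.sum_congr rfl fun j _ => ?_
        simp only [eval_mul, eval_C, eval_pow, eval_X]
        ring
      simp_rw [h2]
      rw [intervalIntegral.integral_finsetSum fun i _ => (hint _).const_mul _]
      refine Finset.sum_eq_zero fun i _ => ?_
      rw [intervalIntegral.integral_const_mul]
      have h3 : T d i = 0 := by rw [hd]; rfl
      simp only [T, LinearMap.coe_mk, AddHom.coe_mk] at h3
      rw [h3, mul_zero]
    have hw0 : ∀ s ∈ Ioo α β, 0 < w.eval s := by
      intro s hs
      simp only [hw, eval_mul, eval_pow, eval_sub, eval_X, eval_C]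
      exact mul_pos (pow_pos (sub_pos.2 hs.1) _) (pow_pos (sub_pos.2 hs.2) _)
    have hnn : ∀ s ∈ Icc α β, 0 ≤ w.eval s := by
      intro s hs
      simp only [hw, eval_mul, eval_pow, eval_sub, eval_X, eval_C]
      exact mul_nonneg (pow_nonneg (sub_nonneg.2 hs.1) _) (pow_nonneg (sub_nonneg.2 hs.2) _)
    have h3 : ∀ s ∈ Ioo α β, (P d).eval s = 0 := by
      by_contra! h
      obtain ⟨s, hs, hne⟩ := h
      have := intervalIntegral.integral_pos hαβ (w * P d * P d).continuous.continuousOn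
        (fun x hx => by
          rw [mul_assoc, eval_mul, eval_mul (p := P d)]
          exact mul_nonneg (hnn x (Ioc_subset_Icc_self hx)) (mul_self_nonneg _))
        ⟨s, Ioo_subset_Icc_self hs, by
          rw [mul_assoc, eval_mul, eval_mul (p := P d)]
          exact mul_pos (hw0 s hs) (mul_self_pos.2 hne)⟩
      rw [h1] at this
      exact lt_irrefl _ this
    have h4 : P d = 0 := by
      refine Polynomial.eq_zero_of_infinite_isRoot _ ((Ioo_infinite hαβ).mono fun s hs => ?_)
      exact h3 s hs
    ext i
    have h5 : (P d).coeff i = d i := by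
      simp only [P, finsetSum_coeff, coeff_C_mul, coeff_X_pow]
      rw [Finset.sum_eq_single i]
      · simp
      · intro j _ hj
        have : (i : ℕ) ≠ j := fun h => hj (Fin.ext h.symm)
        simp [this]
      · simp
    rw [← h5, h4]
    simp
  obtain ⟨d, hd⟩ := (LinearMap.injective_iff_surjective.1 hT) (fun i => c i)
  refine ⟨w * P d, dvd_mul_right _ _, fun i hi => ?_⟩
  have := congr_fun hd ⟨i, hi⟩
  simp only [T, LinearMap.coe_mk, AddHom.coe_mk] at this
  rw [← this]
  simp

/-- A derivative at `0` is, up to the size of a higher derivative, an integral of the function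
against a polynomial density. -/
theorem exists_density_deriv {α β : ℝ} (hα : 0 ≤ α) (hαβ : α < β) (hβ : β ≤ 1) (n M : ℕ) {j : ℕ}
    (hj : j < M) :
    ∃ W : ℝ[X], (X - C α) ^ n * (C β - X) ^ n ∣ W ∧ ∃ K : ℝ, 0 ≤ K ∧
      ∀ (E : Type) [NormedAddCommGroup E] [NormedSpace ℝ E] [CompleteSpace E] (g : ℕ → ℝ → E),
        IsTower (Icc 0 1) g → ∀ B : ℝ, (∀ s ∈ Icc (0 : ℝ) 1, ‖g M s‖ ≤ B) →
          ‖g j 0 - ∫ s in α..β, W.eval s • g 0 s‖ ≤ K * B := by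
  -- These moments extract `g j 0` from the Taylor polynomial of degree `< M`, and the remainder
  -- contributes at most `B ∫ |W|`.
  obtain ⟨W, hW, hc⟩ := exists_polynomial_density hαβ n M
    (fun i => if i = j then (j.factorial : ℝ) else 0)
  refine ⟨W, hW, ∫ s in α..β, ‖W.eval s‖,
    intervalIntegral.integral_nonneg hαβ.le fun _ _ => norm_nonneg _, ?_⟩
  intro E _ _ _ g hg B hB
  have hsub : Icc α β ⊆ Icc 0 1 := Icc_subset_Icc hα hβ
  have hW0 : Continuous fun s => W.eval s := W.continuous
  have h1 : ∫ s in α..β, W.eval s • ∑ i ∈ Finset.range M, (s ^ i / (i.factorial : ℝ)) • g i 0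
      = g j 0 := by
    have : ∀ s, W.eval s • ∑ i ∈ Finset.range M, (s ^ i / (i.factorial : ℝ)) • g i 0
        = ∑ i ∈ Finset.range M, (W.eval s * s ^ i) • ((i.factorial : ℝ)⁻¹ • g i 0) := by
      intro s
      rw [Finset.smul_sum]
      refine Finset.sum_congr rfl fun i _ => ?_
      rw [smul_smul, smul_smul]
      congr 1
      ring
    simp_rw [this]
    rw [intervalIntegral.integral_finsetSum
      fun i _ => by apply Continuous.intervalIntegrable; fun_prop]
    have h2 : ∀ i ∈ Finset.range M, ∫ s in α..β, (W.eval s * s ^ i) • ((i.factorial : ℝ)⁻¹ • g i 0)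
        = if i = j then g j 0 else 0 := by
      intro i hi
      rw [intervalIntegral.integral_smul_const, hc i (Finset.mem_range.1 hi)]
      split_ifs with h
      · subst h
        rw [smul_smul, mul_inv_cancel₀ (by positivity), one_smul]
      · simp
    rw [Finset.sum_congr rfl h2]
    simp [hj]
  have hgi : IntervalIntegrable (fun s => W.eval s • g 0 s) volume α β := by
    apply ContinuousOn.intervalIntegrable
    rw [uIcc_of_le hαβ.le]
    exact hW0.continuousOn.smul ((hg.continuousOn 0).mono hsub)
  have hti : IntervalIntegrable (fun s => W.eval s •
      ∑ i ∈ Finset.range M, (s ^ i / (i.factorial : ℝ)) • g i 0) volume α β := by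
    apply Continuous.intervalIntegrable
    fun_prop
  rw [← h1, ← intervalIntegral.integral_sub hti hgi, ← intervalIntegral.integral_mul_const]
  refine intervalIntegral.norm_integral_le_of_norm_le hαβ.le ?_
    (by apply Continuous.intervalIntegrable; fun_prop)
  refine Eventually.of_forall fun s hs => ?_
  rw [← smul_sub, norm_smul, norm_sub_rev]
  exact mul_le_mul_of_nonneg_left (hg.norm_sub_taylor_le M hB s (hsub (Ioc_subset_Icc_self hs)))
    (norm_nonneg _)

/-- `K` depends only on `α`, `β`, `M`, `j`, because the density does. The window `[α, β]` may stay
away from `0`: `[1/2, 1]` serves for interpolation near endpoints, `[0, 1]` for the inverse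
estimate. -/
theorem exists_norm_deriv_le {α β : ℝ} (hα : 0 ≤ α) (hαβ : α < β) (hβ : β ≤ 1) (M : ℕ) {j : ℕ}
    (hj : j < M) :
    ∃ K : ℝ, 0 ≤ K ∧
      ∀ (E : Type) [NormedAddCommGroup E] [NormedSpace ℝ E] [CompleteSpace E] (g : ℕ → ℝ → E),
        IsTower (Icc 0 1) g → ∀ B : ℝ, (∀ s ∈ Icc (0 : ℝ) 1, ‖g M s‖ ≤ B) →
          ‖g j 0‖ ≤ K * ((∫ s in α..β, ‖g 0 s‖) + B) := by
  obtain ⟨W, -, K, hK, h⟩ := exists_density_deriv hα hαβ hβ 0 M hj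
  obtain ⟨K', hK'⟩ := isCompact_Icc.exists_bound_of_continuousOn (s := Icc α β)
    W.continuous.continuousOn
  have hK'0 : 0 ≤ K' := (norm_nonneg _).trans (hK' α ⟨le_rfl, hαβ.le⟩)
  refine ⟨max K K', le_max_of_le_left hK, ?_⟩
  intro E _ _ _ g hg B hB
  have hB0 : 0 ≤ B := (norm_nonneg _).trans (hB 0 (by simp))
  have hc : ContinuousOn (g 0) (Icc α β) := (hg.continuousOn 0).mono (Icc_subset_Icc hα hβ)
  have hi : IntervalIntegrable (fun s => ‖g 0 s‖) volume α β := by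
    apply ContinuousOn.intervalIntegrable
    rw [uIcc_of_le hαβ.le]
    exact hc.norm
  have h1 := h E g hg B hB
  have h2 : ‖∫ s in α..β, W.eval s • g 0 s‖ ≤ K' * ∫ s in α..β, ‖g 0 s‖ := by
    rw [← intervalIntegral.integral_const_mul]
    refine intervalIntegral.norm_integral_le_of_norm_le hαβ.le ?_ (hi.const_mul _)
    refine Eventually.of_forall fun s hs => ?_
    rw [norm_smul]
    exact mul_le_mul_of_nonneg_right (hK' s (Ioc_subset_Icc_self hs)) (norm_nonneg _)
  have h3 : 0 ≤ ∫ s in α..β, ‖g 0 s‖ :=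
    intervalIntegral.integral_nonneg hαβ.le fun _ _ => norm_nonneg _
  have h4 := norm_le_norm_add_norm_sub' (g j 0) (∫ s in α..β, W.eval s • g 0 s)
  rw [mul_add]
  nlinarith [mul_le_mul_of_nonneg_right (le_max_left K K') hB0,
    mul_le_mul_of_nonneg_right (le_max_right K K') h3]

/-- Interpolation: a function on `[a, b]` that is small away from the endpoints and has a bounded
derivative of order `M` is small everywhere, and so are its derivatives of order `< M`. -/
theorem exists_norm_deriv_le_of_interior (M : ℕ) {j : ℕ} (hj : j < M) :
    ∃ K : ℝ, 0 ≤ K ∧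
      ∀ (E : Type) [NormedAddCommGroup E] [NormedSpace ℝ E] [CompleteSpace E] (a b h A B : ℝ) (f : ℕ → ℝ → E),
        0 < h → 12 * h ≤ b - a → IsTower (Icc a b) f → (∀ t ∈ Icc a b, ‖f M t‖ ≤ B) →
        (∀ t ∈ Icc (a + 2 * h) (b - 2 * h), ‖f 0 t‖ ≤ A) →
          ∀ t ∈ Icc a b, h ^ j * ‖f j t‖ ≤ K * (A + B * h ^ M) := by
  obtain ⟨K, hK, H⟩ := exists_norm_deriv_le (α := 1 / 2) (β := 1) (by norm_num) (by norm_num)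
    le_rfl M hj
  refine ⟨K * 4 ^ M, by positivity, ?_⟩
  intro E _ _ _ a b h A B f hh hab hf hB hA t ht
  have hA0 : 0 ≤ A := (norm_nonneg _).trans (hA (a + 2 * h) ⟨le_rfl, by linarith⟩)
  have hB0 : 0 ≤ B := (norm_nonneg _).trans (hB a ⟨le_rfl, by linarith⟩)
  -- From `t`, go a distance `4h` towards the farther endpoint. The segment stays in `[a, b]`, and
  -- its outer half lies at distance at least `2h` from both ends because `12h ≤ b - a`.
  obtain ⟨η, hη, hm, hm'⟩ : ∃ η : ℝ, |η| = 4 * h ∧ MapsTo (fun s => t + η * s) (Icc 0 1) (Icc a b) ∧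
      MapsTo (fun s => t + η * s) (Icc (1 / 2) 1) (Icc (a + 2 * h) (b - 2 * h)) := by
    rcases le_total t ((a + b) / 2) with h1 | h1
    · refine ⟨4 * h, abs_of_pos (by linarith), ?_, ?_⟩
      · intro s hs
        have := mul_le_mul_of_nonneg_left hs.2 hh.le
        have := mul_nonneg hh.le hs.1
        exact ⟨by linarith [ht.1], by linarith [ht.1]⟩
      · intro s hs
        have := mul_le_mul_of_nonneg_left hs.2 hh.le
        have := mul_le_mul_of_nonneg_left hs.1 hh.le
        exact ⟨by linarith [ht.1], by linarith [ht.1]⟩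
    · refine ⟨-(4 * h), by rw [abs_neg, abs_of_pos (by linarith)], ?_, ?_⟩
      · intro s hs
        have := mul_le_mul_of_nonneg_left hs.2 hh.le
        have := mul_nonneg hh.le hs.1
        exact ⟨by linarith [ht.2], by linarith [ht.2]⟩
      · intro s hs
        have := mul_le_mul_of_nonneg_left hs.2 hh.le
        have := mul_le_mul_of_nonneg_left hs.1 hh.le
        exact ⟨by linarith [ht.2], by linarith [ht.2]⟩
  have hg := hf.comp_affine η t hm
  have h1 := H E _ hg (B * (4 * h) ^ M) (fun s hs => by
    rw [norm_smul, norm_pow, Real.norm_eq_abs, hη, mul_comm]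
    exact mul_le_mul_of_nonneg_right (hB _ (hm hs)) (by positivity))
  simp only [pow_zero, one_smul, mul_zero, add_zero, norm_smul, norm_pow, Real.norm_eq_abs, hη]
    at h1
  have h2 : ∫ s in (1 / 2 : ℝ)..1, ‖f 0 (t + η * s)‖ ≤ A := by
    have h3 : ‖∫ s in (1 / 2 : ℝ)..1, ‖f 0 (t + η * s)‖‖ ≤ A * |1 - 1 / 2| := by
      apply intervalIntegral.norm_integral_le_of_norm_le_const
      intro s hs
      rw [norm_norm]
      rw [uIoc_of_le (by norm_num)] at hs
      exact hA _ (hm' (Ioc_subset_Icc_self hs))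
    rw [abs_of_nonneg (by norm_num)] at h3
    exact (le_abs_self _).trans (h3.trans (by linarith))
  have h5 : h ^ j * ‖f j t‖ ≤ (4 * h) ^ j * ‖f j t‖ := by
    gcongr
    linarith
  refine h5.trans (h1.trans ?_)
  rw [mul_assoc]
  refine mul_le_mul_of_nonneg_left ?_ hK
  rw [mul_pow, mul_add]
  have : A ≤ 4 ^ M * A := le_mul_of_one_le_left hA0 (one_le_pow₀ (by norm_num))
  nlinarith

end Tower

/-! ### Uniform bounds on the derivatives of the Lagrangian along a curve -/

section Smoothness

open MeasureTheory

variable {N n : ℕ} {E F : Type} [NormedAddCommGroup E] [NormedSpace ℝ E] [NormedAddCommGroup F]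
  [NormedSpace ℝ F]

theorem IsTower.contDiffOn {S : Set ℝ} (hS : UniqueDiffOn ℝ S) {f : ℕ → ℝ → E}
    (hf : IsTower S f) : ContDiffOn ℝ ∞ (f 0) S := by
  refine contDiffOn_of_differentiableOn_deriv fun m _ t ht => ?_
  exact ((hf m t ht).congr (fun s hs => hf.iteratedDerivWithin_eq hS m hs)
    (hf.iteratedDerivWithin_eq hS m ht)).differentiableWithinAt

theorem hasDerivAt_iteratedDeriv {f : ℝ → E} {t : ℝ} (hf : ContDiffAt ℝ ∞ f t) (j : ℕ) :
    HasDerivAt (iteratedDeriv j f) (iteratedDeriv (j + 1) f t) t := by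
  have h : DifferentiableWithinAt ℝ (iteratedDerivWithin j f univ) univ t :=
    ContDiffWithinAt.differentiableWithinAt_iteratedDerivWithin (n := ∞) hf.contDiffWithinAt
      (by exact_mod_cast ENat.natCast_lt_top j) (by simp)
  rw [iteratedDerivWithin_univ, differentiableWithinAt_univ] at h
  simpa [iteratedDeriv_succ] using h.hasDerivAt

theorem isTower_iteratedDeriv {S : Set ℝ} {f : ℝ → E} (hf : ∀ t ∈ S, ContDiffAt ℝ ∞ f t) :
    IsTower S (fun j => iteratedDeriv j f) :=
  fun j t ht => (hasDerivAt_iteratedDeriv (hf t ht) j).hasDerivWithinAt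

theorem isTower_jet {a b : ℝ} (hab : a < b) {x : ℝ → Conf N} (hx : ContDiffOn ℝ ∞ x (Icc a b)) :
    IsTower (Icc a b) (fun j t (i : Fin (n + 1)) =>
      iteratedDerivWithin ((i : ℕ) + j) x (Icc a b) t) := by
  intro j t ht
  rw [hasDerivWithinAt_pi]
  exact fun i => isTower_iteratedDerivWithin (uniqueDiffOn_Icc hab) hx (i + j) t ht

theorem contDiffOn_jet {a b : ℝ} (hab : a < b) {x : ℝ → Conf N}
    (hx : ContDiffOn ℝ ∞ x (Icc a b)) : ContDiffOn ℝ ∞ (jet n a b x) (Icc a b) :=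
  (isTower_jet (n := n) hab hx).contDiffOn (uniqueDiffOn_Icc hab)

theorem contDiff_partialL {L : Jet N n → ℝ} (hL : ContDiff ℝ ∞ L) (i : ℕ) :
    ContDiff ℝ ∞ (partialL L i) := by
  unfold partialL
  split_ifs with hi
  · exact (hL.fderiv_right (m := ∞) (by simp)).clm_comp contDiff_const
  · exact contDiff_const

theorem contDiffOn_partialAlong {a b : ℝ} (hab : a < b) {L : Jet N n → ℝ} (hL : ContDiff ℝ ∞ L)
    {x : ℝ → Conf N} (hx : ContDiffOn ℝ ∞ x (Icc a b)) (i : ℕ) :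
    ContDiffOn ℝ ∞ (partialAlong a b L x i) (Icc a b) :=
  (contDiff_partialL hL i).comp_contDiffOn (contDiffOn_jet hab hx)

/-- The derivatives of `∂L/∂x^(i)` along a curve. -/
def partialTower (a b : ℝ) (L : Jet N n → ℝ) (x : ℝ → Conf N) (i j : ℕ) (t : ℝ) :
    Conf N →L[ℝ] ℝ :=
  iteratedDerivWithin j (partialAlong a b L x i) (Icc a b) t

/-- The derivatives of the Euler-Lagrange expression along a curve. -/
def elTower (a b : ℝ) (L : Jet N n → ℝ) (x : ℝ → Conf N) (j : ℕ) (t : ℝ) :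
    Conf N →L[ℝ] ℝ :=
  ∑ i ∈ Finset.range (n + 1), (-1 : ℝ) ^ i • partialTower a b L x i (j + i) t

theorem partialTower_zero (a b : ℝ) (L : Jet N n → ℝ) (x : ℝ → Conf N) (i : ℕ) :
    partialTower a b L x i 0 = partialAlong a b L x i := by
  ext1 t
  simp [partialTower]

theorem elTower_zero (a b : ℝ) (L : Jet N n → ℝ) (x : ℝ → Conf N) :
    elTower a b L x 0 = eulerLagrange a b L x := by
  ext1 t
  simp [elTower, eulerLagrange, partialTower]

theorem isTower_partialTower {a b : ℝ} (hab : a < b) {L : Jet N n → ℝ} (hL : ContDiff ℝ ∞ L)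
    {x : ℝ → Conf N} (hx : ContDiffOn ℝ ∞ x (Icc a b)) (i : ℕ) :
    IsTower (Icc a b) (partialTower a b L x i) :=
  isTower_iteratedDerivWithin (uniqueDiffOn_Icc hab) (contDiffOn_partialAlong hab hL hx i)

theorem isTower_elTower {a b : ℝ} (hab : a < b) {L : Jet N n → ℝ} (hL : ContDiff ℝ ∞ L)
    {x : ℝ → Conf N} (hx : ContDiffOn ℝ ∞ x (Icc a b)) :
    IsTower (Icc a b) (elTower a b L x) := by
  intro j t ht
  refine HasDerivWithinAt.fun_sum fun i _ => ?_
  have := ((isTower_partialTower hab hL hx i) (j + i) t ht).const_smul ((-1 : ℝ) ^ i)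
  rwa [show j + i + 1 = j + 1 + i by ring] at this

theorem exists_bound_partialTower {a b : ℝ} (hab : a < b) {L : ℝ → Jet N n → ℝ}
    (hL : IsLagrangianFamily L) {x : ℝ → ℝ → Conf N} (hx : IsAdmissible a b x) :
    ∃ hmax : ℝ, 0 < hmax ∧ ∀ i m : ℕ, ∃ C : ℝ, ∀ h ∈ Ioc 0 hmax, ∀ t ∈ Icc a b,
      ‖partialTower a b (L h) (x h) i m t‖ ≤ C := by
  obtain ⟨h₁, hh₁, hLb⟩ := hL.bounded
  obtain ⟨h₂, hh₂, hxb⟩ := hx.bounded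
  choose cx hcx using hxb
  refine ⟨min h₁ h₂, lt_min hh₁ hh₂, fun i m => ?_⟩
  by_cases hi : i < n + 1
  swap
  · refine ⟨0, fun h _ t _ => ?_⟩
    have : partialAlong a b (L h) (x h) i = fun _ => 0 := by
      ext1 t
      simp [partialAlong, partialL, hi]
    simp [partialTower, this]
  set R : ℕ → ℝ := fun j => ∑ r ∈ Finset.range (n + 1), |cx (r + j)| with hR
  have hR0 : ∀ j, 0 ≤ R j := fun j => Finset.sum_nonneg fun _ _ => abs_nonneg _
  have hjet : ∀ h ∈ Ioc 0 (min h₁ h₂), ∀ j, ∀ t ∈ Icc a b,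
      ‖iteratedFDerivWithin ℝ j (jet n a b (x h)) (Icc a b) t‖ ≤ R j := by
    intro h hh j t ht
    rw [norm_iteratedFDerivWithin_eq_norm_iteratedDerivWithin]
    have h1 := (isTower_jet (n := n) hab (hx.smooth h hh.1)).iteratedDerivWithin_eq
      (uniqueDiffOn_Icc hab) j ht
    have h2 : (iteratedDerivWithin j (jet n a b (x h)) (Icc a b) t) = _ := h1
    rw [h2, pi_norm_le_iff_of_nonneg (hR0 j)]
    intro r
    refine (hcx _ h ⟨hh.1, hh.2.trans (min_le_right _ _)⟩ t ht).trans ((le_abs_self _).trans ?_)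
    exact Finset.single_le_sum (f := fun r => |cx (r + j)|) (fun _ _ => abs_nonneg _)
      (Finset.mem_range.2 r.2)
  -- All jets of the family lie in one closed ball, a compact set independent of `h`, on which the
  -- derivatives of `L h` are uniformly bounded.
  choose cL hcL using fun m => hLb m (Metric.closedBall 0 (R 0)) (isCompact_closedBall _ _)
  let Λ : (Jet N n →L[ℝ] ℝ) →L[ℝ] (Conf N →L[ℝ] ℝ) :=
    (ContinuousLinearMap.compL ℝ (Conf N) (Jet N n) ℝ).flip
      (ContinuousLinearMap.single ℝ (fun _ : Fin (n + 1) => Conf N) ⟨i, hi⟩)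
  set C : ℝ := ∑ j ∈ Finset.range (m + 1), ‖Λ‖ * |cL (j + 1)| with hC
  -- The bound for derivatives of a composition asks for `D ^ j` at order `j ≥ 1`; the summand `1`
  -- ensures `D ≤ D ^ j`.
  set D : ℝ := 1 + ∑ j ∈ Finset.range (m + 1), R j with hD
  refine ⟨m.factorial * C * D ^ m, fun h hh t ht => ?_⟩
  have hfun : partialAlong a b (L h) (x h) i = (Λ ∘ fderiv ℝ (L h)) ∘ jet n a b (x h) := by
    ext1 t
    simp [partialAlong, partialL, hi, Λ]
  have hLs := hL.smooth h hh.1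
  have hfd : ContDiff ℝ ∞ (fderiv ℝ (L h)) := hLs.fderiv_right (by simp)
  rw [partialTower, hfun, ← norm_iteratedFDerivWithin_eq_norm_iteratedDerivWithin]
  refine norm_iteratedFDerivWithin_comp_le (N := ∞) (t := univ)
    (Λ.contDiff.comp hfd).contDiffOn
    (contDiffOn_jet hab (hx.smooth h hh.1)) (by exact_mod_cast le_top) uniqueDiffOn_univ
    (uniqueDiffOn_Icc hab) (mapsTo_univ _ _) ht (fun j hj => ?_) (fun j hj1 hj => ?_)
  · rw [iteratedFDerivWithin_univ]
    refine (Λ.norm_iteratedFDeriv_comp_left (N := ∞) hfd.contDiffAt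
      (by exact_mod_cast le_top)).trans ?_
    rw [norm_iteratedFDeriv_fderiv]
    have hmem : jet n a b (x h) t ∈ Metric.closedBall (0 : Jet N n) (R 0) := by
      rw [mem_closedBall_zero_iff]
      simpa using hjet h hh 0 t ht
    have h3 := hcL (j + 1) h ⟨hh.1, hh.2.trans (min_le_left _ _)⟩ _ hmem
    refine le_trans (mul_le_mul_of_nonneg_left (h3.trans (le_abs_self _)) (norm_nonneg _)) ?_
    exact Finset.single_le_sum (f := fun j => ‖Λ‖ * |cL (j + 1)|)
      (fun _ _ => by positivity) (Finset.mem_range.2 (Nat.lt_succ_of_le hj))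
  · have hD1 : 1 ≤ D := le_add_of_nonneg_right (Finset.sum_nonneg fun _ _ => hR0 _)
    refine (hjet h hh j t ht).trans (le_trans ?_ (le_self_pow₀ hD1 (by omega)))
    have := Finset.single_le_sum (f := R) (fun _ _ => hR0 _)
      (Finset.mem_range.2 (Nat.lt_succ_of_le hj))
    linarith

theorem exists_bound_elTower {a b : ℝ} (hab : a < b) {L : ℝ → Jet N n → ℝ}
    (hL : IsLagrangianFamily L) {x : ℝ → ℝ → Conf N} (hx : IsAdmissible a b x) :
    ∃ hmax : ℝ, 0 < hmax ∧ ∀ m : ℕ, ∃ C : ℝ, ∀ h ∈ Ioc 0 hmax, ∀ t ∈ Icc a b,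
      ‖elTower a b (L h) (x h) m t‖ ≤ C := by
  obtain ⟨hmax, hh, H⟩ := exists_bound_partialTower hab hL hx
  choose c hc using H
  refine ⟨hmax, hh, fun m => ⟨∑ i ∈ Finset.range (n + 1), c i (m + i), fun h hh t ht => ?_⟩⟩
  refine (norm_sum_le _ _).trans (Finset.sum_le_sum fun i _ => ?_)
  rw [norm_smul]
  simpa using hc i (m + i) h hh t ht

end Smoothness

/-! ### Differentiating the action under the integral sign -/

section FirstVariation

open MeasureTheory

variable {N n : ℕ} {V : Type} [NormedAddCommGroup V] [NormedSpace ℝ V]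

/-- For `|ε| < 1` the argument of `L` stays in a fixed ball, so `fderiv ℝ L` is bounded there and a
constant dominates the integrand. Measurability and almost everywhere bounds are all that is
available for the derivatives of a kinked variation. -/
theorem hasDerivAt_integral_add_smul [ProperSpace V] {L : V → ℝ} (hL : ContDiff ℝ 1 L) {a b : ℝ}
    (hab : a ≤ b) {X D : ℝ → V} (hX : AEStronglyMeasurable X (volume.restrict (Ioc a b)))
    (hD : AEStronglyMeasurable D (volume.restrict (Ioc a b))) {C : ℝ}
    (hXC : ∀ᵐ t ∂(volume.restrict (Ioc a b)), ‖X t‖ ≤ C)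
    (hDC : ∀ᵐ t ∂(volume.restrict (Ioc a b)), ‖D t‖ ≤ C) :
    HasDerivAt (fun ε : ℝ => ∫ t in a..b, L (X t + ε • D t))
      (∫ t in a..b, fderiv ℝ L (X t) (D t)) 0 := by
  have hfd : Continuous (fderiv ℝ L) := hL.continuous_fderiv (by norm_num)
  obtain ⟨K, hK⟩ := (isCompact_closedBall (0 : V) (2 * C)).exists_bound_of_continuousOn
    hfd.continuousOn
  obtain ⟨K₀, hK₀⟩ := (isCompact_closedBall (0 : V) (2 * C)).exists_bound_of_continuousOn
    hL.continuous.continuousOn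
  simp_rw [intervalIntegral.integral_of_le hab]
  have hmeas : ∀ ε : ℝ, AEStronglyMeasurable (fun t => X t + ε • D t)
      (volume.restrict (Ioc a b)) := fun ε => hX.add (hD.const_smul ε)
  have hball : ∀ᵐ t ∂(volume.restrict (Ioc a b)), ∀ ε ∈ Metric.ball (0 : ℝ) 1,
      X t + ε • D t ∈ Metric.closedBall (0 : V) (2 * C) := by
    filter_upwards [hXC, hDC] with t h1 h2 ε hε
    rw [mem_closedBall_zero_iff]
    refine (norm_add_le _ _).trans ?_
    rw [norm_smul]
    rw [mem_ball_zero_iff] at hε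
    nlinarith [norm_nonneg (D t)]
  have key := (hasDerivAt_integral_of_dominated_loc_of_deriv_le (μ := volume.restrict (Ioc a b))
    (F := fun (ε : ℝ) t => L (X t + ε • D t))
    (F' := fun (ε : ℝ) t => fderiv ℝ L (X t + ε • D t) (D t)) (x₀ := (0 : ℝ))
    (s := Metric.ball 0 1) (bound := fun _ => K * C) (Metric.ball_mem_nhds _ one_pos)
    (Eventually.of_forall fun ε => hL.continuous.comp_aestronglyMeasurable (hmeas ε))
    ?_ ?_ ?_ (integrable_const _) ?_).2
  · simpa using key
  · refine Integrable.of_bound (hL.continuous.comp_aestronglyMeasurable (hmeas 0)) K₀ ?_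
    filter_upwards [hball] with t ht
    exact hK₀ _ (ht 0 (Metric.mem_ball_self one_pos))
  · have hc : Continuous fun p : V × V => fderiv ℝ L p.1 p.2 :=
      (hfd.comp continuous_fst).clm_apply continuous_snd
    exact hc.comp_aestronglyMeasurable ((hmeas 0).prodMk hD)
  · filter_upwards [hball, hDC] with t ht h2 ε hε
    refine (ContinuousLinearMap.le_opNorm _ _).trans ?_
    exact mul_le_mul (hK _ (ht ε hε)) h2 (norm_nonneg _) ((norm_nonneg _).trans (hK _ (ht ε hε)))
  · refine Eventually.of_forall fun t ε _ => ?_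
    have h1 : HasFDerivAt L (fderiv ℝ L (X t + ε • D t)) (X t + ε • D t) :=
      (hL.differentiable (by norm_num) _).hasFDerivAt
    have h2 : HasDerivAt (fun ε : ℝ => X t + ε • D t) (D t) ε := by
      simpa using ((hasDerivAt_id ε).smul_const (D t)).const_add (X t)
    exact h1.comp_hasDerivAt ε h2

theorem ae_restrict_notMem_countable {Z : Set ℝ} (hZ : Z.Countable) (S : Set ℝ) :
    ∀ᵐ t ∂(volume.restrict S), t ∉ Z :=
  ae_restrict_of_ae (measure_eq_zero_iff_ae_notMem.1 (hZ.measure_zero volume))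

theorem aestronglyMeasurable_iteratedDeriv {y : ℝ → V} {Z : Set ℝ} (hZ : Z.Countable)
    (hy : ∀ t, t ∉ Z → ContDiffAt ℝ ∞ y t) (i : ℕ) (S : Set ℝ) :
    AEStronglyMeasurable (iteratedDeriv i y) (volume.restrict S) := by
  have h1 : ContinuousOn (iteratedDeriv i y) Zᶜ := fun t ht =>
    (hasDerivAt_iteratedDeriv (hy t ht) i).continuousAt.continuousWithinAt
  have h2 := h1.aestronglyMeasurable (μ := volume) hZ.measurableSet.compl
  have h3 : (volume : Measure ℝ).restrict Zᶜ = volume :=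
    Measure.restrict_eq_self_of_ae_mem
      (measure_eq_zero_iff_ae_notMem.1 (hZ.measure_zero volume))
  rw [h3] at h2
  exact h2.restrict

theorem intervalIntegrable_iteratedDeriv {a b : ℝ} (hab : a ≤ b) {y : ℝ → V} {Z : Set ℝ}
    (hZ : Z.Countable) (hy : ∀ t, t ∉ Z → ContDiffAt ℝ ∞ y t) {i : ℕ} {C : ℝ}
    (hC : ∀ t ∈ Icc a b, t ∉ Z → ‖iteratedDeriv i y t‖ ≤ C) :
    IntervalIntegrable (iteratedDeriv i y) volume a b := by
  rw [intervalIntegrable_iff_integrableOn_Ioc_of_le hab]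
  refine Integrable.of_bound (aestronglyMeasurable_iteratedDeriv hZ hy i _) C ?_
  filter_upwards [ae_restrict_notMem_countable hZ (Ioc a b), ae_restrict_mem measurableSet_Ioc]
    with t h1 h2
  exact hC t (Ioc_subset_Icc_self h2) h1

theorem intervalIntegrable_clm_iteratedDeriv {a b : ℝ} (hab : a ≤ b) {y : ℝ → V} {Z : Set ℝ}
    (hZ : Z.Countable) (hy : ∀ t, t ∉ Z → ContDiffAt ℝ ∞ y t) {i : ℕ} {C : ℝ}
    (hC : ∀ t ∈ Icc a b, t ∉ Z → ‖iteratedDeriv i y t‖ ≤ C) {A : ℝ → V →L[ℝ] ℝ}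
    (hA : ContinuousOn A (Icc a b)) :
    IntervalIntegrable (fun t => A t (iteratedDeriv i y t)) volume a b := by
  rw [intervalIntegrable_iff_integrableOn_Ioc_of_le hab]
  obtain ⟨K, hK⟩ := isCompact_Icc.exists_bound_of_continuousOn hA
  have hAm : AEStronglyMeasurable A (volume.restrict (Ioc a b)) :=
    (hA.mono Ioc_subset_Icc_self).aestronglyMeasurable measurableSet_Ioc
  have hc : Continuous fun p : (V →L[ℝ] ℝ) × V => p.1 p.2 :=
    continuous_fst.clm_apply continuous_snd
  refine Integrable.of_bound (hc.comp_aestronglyMeasurable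
    (hAm.prodMk (aestronglyMeasurable_iteratedDeriv hZ hy i _))) (K * C) ?_
  filter_upwards [ae_restrict_notMem_countable hZ (Ioc a b), ae_restrict_mem measurableSet_Ioc]
    with t h1 h2
  have ht := Ioc_subset_Icc_self h2
  exact (ContinuousLinearMap.le_opNorm _ _).trans
    (mul_le_mul (hK t ht) (hC t ht h1) (norm_nonneg _) ((norm_nonneg _).trans (hK t ht)))

theorem jet_add_smul {a b : ℝ} (hab : a < b) {x y : ℝ → Conf N}
    (hx : ContDiffOn ℝ ∞ x (Icc a b)) {t : ℝ} (ht : t ∈ Icc a b) (hy : ContDiffAt ℝ ∞ y t)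
    (ε : ℝ) :
    jet n a b (fun s => x s + ε • y s) t
      = jet n a b x t + ε • (fun i : Fin (n + 1) => iteratedDeriv (i : ℕ) y t) := by
  ext1 i
  have hu := uniqueDiffOn_Icc hab
  have hx' : ContDiffWithinAt ℝ (i : ℕ) x (Icc a b) t :=
    (hx t ht).of_le (by exact_mod_cast le_top)
  have hy' : ContDiffAt ℝ (i : ℕ) y t := hy.of_le (by exact_mod_cast le_top)
  simp only [jet, Pi.add_apply, Pi.smul_apply]
  rw [iteratedDerivWithin_fun_add ht hu hx' (hy'.contDiffWithinAt.const_smul ε),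
    iteratedDerivWithin_fun_const_smul ht hu ε hy'.contDiffWithinAt,
    iteratedDerivWithin_eq_iteratedDeriv hu hy' ht]

theorem fderiv_eq_sum_partialL (L : Jet N n → ℝ) (u v : Jet N n) :
    fderiv ℝ L u v = ∑ i : Fin (n + 1), partialL L i u (v i) := by
  have h1 : v = ∑ i : Fin (n + 1), Pi.single i (v i) := (Finset.univ_sum_single v).symm
  conv_lhs => rw [h1, map_sum]
  refine Finset.sum_congr rfl fun i _ => ?_
  simp [partialL, i.2]

/-- `Z` is a null set containing the nonsmooth points: empty for smooth variations, the mesh for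
meshed ones. Both cases share this formula, before any integration by parts. -/
theorem firstVariation_eq {a b : ℝ} (hab : a < b) {L : Jet N n → ℝ} (hL : ContDiff ℝ ∞ L)
    {x : ℝ → Conf N} (hx : ContDiffOn ℝ ∞ x (Icc a b)) {y : ℝ → Conf N} {Z : Set ℝ}
    (hZ : Z.Countable) (hy : ∀ t, t ∉ Z → ContDiffAt ℝ ∞ y t)
    (hC : ∀ i, ∃ C, ∀ t ∈ Icc a b, t ∉ Z → ‖iteratedDeriv i y t‖ ≤ C) :
    firstVariation a b L x y = ∑ i ∈ Finset.range (n + 1),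
      ∫ t in a..b, partialTower a b L x i 0 t (iteratedDeriv i y t) := by
  choose c hc using hC
  have hjc : ContinuousOn (jet n a b x) (Icc a b) := (contDiffOn_jet hab hx).continuousOn
  obtain ⟨C₁, hC₁⟩ := isCompact_Icc.exists_bound_of_continuousOn hjc
  set C₂ : ℝ := ∑ i ∈ Finset.range (n + 1), |c i|
  set D : ℝ → Jet N n := fun t i => iteratedDeriv (i : ℕ) y t with hDdef
  have hD : ∀ t ∈ Icc a b, t ∉ Z → ‖D t‖ ≤ C₂ := by
    intro t ht htZ
    rw [pi_norm_le_iff_of_nonneg (Finset.sum_nonneg fun _ _ => abs_nonneg _)]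
    intro i
    refine (hc i t ht htZ).trans ((le_abs_self _).trans ?_)
    exact Finset.single_le_sum (f := fun i => |c i|) (fun _ _ => abs_nonneg _)
      (Finset.mem_range.2 i.2)
  have hae : ∀ᵐ t ∂(volume.restrict (Ioc a b)), t ∈ Icc a b ∧ t ∉ Z := by
    filter_upwards [ae_restrict_notMem_countable hZ (Ioc a b),
      ae_restrict_mem measurableSet_Ioc] with t h1 h2
    exact ⟨Ioc_subset_Icc_self h2, h1⟩
  have hDm : AEStronglyMeasurable D (volume.restrict (Ioc a b)) := by
    refine AEMeasurable.aestronglyMeasurable (aemeasurable_pi_iff.2 fun i => ?_)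
    exact (aestronglyMeasurable_iteratedDeriv hZ hy i _).aemeasurable
  have key := hasDerivAt_integral_add_smul (hL.of_le (by exact_mod_cast le_top)) hab.le
    (X := jet n a b x) (D := D) (C := max C₁ C₂)
    ((hjc.mono Ioc_subset_Icc_self).aestronglyMeasurable measurableSet_Ioc)
    hDm
    (hae.mono fun t ht => (hC₁ t ht.1).trans (le_max_left _ _))
    (hae.mono fun t ht => (hD t ht.1 ht.2).trans (le_max_right _ _))
  have h1 : (fun ε : ℝ => action a b L (fun t => x t + ε • y t))
      = fun ε : ℝ => ∫ t in a..b, L (jet n a b x t + ε • D t) := by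
    ext1 ε
    rw [action, intervalIntegral.integral_of_le hab.le, intervalIntegral.integral_of_le hab.le]
    refine integral_congr_ae (hae.mono fun t ht => ?_)
    simp only
    rw [jet_add_smul hab hx ht.1 (hy t ht.2)]
  rw [firstVariation, h1, key.deriv, ← intervalIntegral.integral_finsetSum]
  · congr 1
    ext1 t
    rw [fderiv_eq_sum_partialL,
      ← Fin.sum_univ_eq_sum_range (fun i => partialTower a b L x i 0 t (iteratedDeriv i y t))]
    exact Finset.sum_congr rfl fun i _ => by rw [partialTower_zero]; rfl
  · intro i _
    exact intervalIntegrable_clm_iteratedDeriv hab.le hZ hy (hc i)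
      ((isTower_partialTower hab hL hx i).continuousOn 0)

end FirstVariation

/-! ### Iterated integration by parts -/

section Parts

open MeasureTheory

variable {N n : ℕ} {V : Type} [NormedAddCommGroup V] [NormedSpace ℝ V]

theorem IsTower.intervalIntegrable_clm {s s' : ℝ} (hs : s ≤ s') {A : ℕ → ℝ → V →L[ℝ] ℝ}
    {y : ℕ → ℝ → V} (hA : IsTower (Icc s s') A) (hy : IsTower (Icc s s') y) (j i : ℕ) :
    IntervalIntegrable (fun t => A j t (y i t)) volume s s' := by
  apply ContinuousOn.intervalIntegrable
  rw [uIcc_of_le hs]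
  exact (hA.continuousOn j).clm_apply (hy.continuousOn i)

theorem IsTower.integral_clm_succ {s s' : ℝ} (hs : s ≤ s') {A : ℕ → ℝ → V →L[ℝ] ℝ}
    {y : ℕ → ℝ → V} (hA : IsTower (Icc s s') A) (hy : IsTower (Icc s s') y) (j i : ℕ) :
    ∫ t in s..s', A j t (y (i + 1) t)
      = A j s' (y i s') - A j s (y i s) - ∫ t in s..s', A (j + 1) t (y i t) := by
  have h1 := hA.intervalIntegrable_clm hs hy j (i + 1)
  have h2 := hA.intervalIntegrable_clm hs hy (j + 1) i
  rw [eq_sub_iff_add_eq, ← intervalIntegral.integral_add h1 h2]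
  refine intervalIntegral.integral_eq_sub_of_hasDerivAt_of_le hs
    (f := fun t => A j t (y i t)) ((hA.continuousOn j).clm_apply (hy.continuousOn i)) ?_
    (h1.add h2)
  intro t ht
  have h3 := (hA j t (Ioo_subset_Icc_self ht)).hasDerivAt (Icc_mem_nhds ht.1 ht.2)
  have h4 := (hy i t (Ioo_subset_Icc_self ht)).hasDerivAt (Icc_mem_nhds ht.1 ht.2)
  rw [add_comm]
  exact h3.clm_apply h4

theorem IsTower.integral_clm_iterate {s s' : ℝ} (hs : s ≤ s') {A : ℕ → ℝ → V →L[ℝ] ℝ}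
    {y : ℕ → ℝ → V} (hA : IsTower (Icc s s') A) (hy : IsTower (Icc s s') y) (i j : ℕ)
    (h0 : ∀ r < i, y r s = 0 ∧ y r s' = 0) :
    ∫ t in s..s', A j t (y i t) = (-1) ^ i * ∫ t in s..s', A (j + i) t (y 0 t) := by
  induction i generalizing j with
  | zero => simp
  | succ i ih =>
    rw [hA.integral_clm_succ hs hy, (h0 i i.lt_succ_self).1, (h0 i i.lt_succ_self).2,
      ih (j + 1) fun r hr => h0 r (hr.trans i.lt_succ_self), show j + 1 + i = j + (i + 1) by ring]
    simp [pow_succ]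

/-- Made for a variation whose `i`-th derivative is the first not to vanish at `s`, while it still
vanishes at `s'`: a single boundary term survives and exposes the value of `A j` at `s`. -/
theorem IsTower.integral_clm_iterate_boundary {s s' : ℝ} (hs : s ≤ s') {A : ℕ → ℝ → V →L[ℝ] ℝ}
    {y : ℕ → ℝ → V} (hA : IsTower (Icc s s') A) (hy : IsTower (Icc s s') y) (i j : ℕ)
    (h0 : ∀ r < i, y r s = 0 ∧ y r s' = 0) (h1 : y i s' = 0) :
    ∫ t in s..s', A j t (y (i + 1) t) = (-1) ^ (i + 1) * (∫ t in s..s', A (j + (i + 1)) t (y 0 t))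
      - A j s (y i s) := by
  rw [hA.integral_clm_succ hs hy, h1, hA.integral_clm_iterate hs hy i (j + 1) h0,
    show j + 1 + i = j + (i + 1) by ring, pow_succ]
  simp
  ring

theorem integral_elTower {a b s s' : ℝ} (hs : s ≤ s') (has : Icc s s' ⊆ Icc a b)
    (hab : a < b) {L : Jet N n → ℝ} (hL : ContDiff ℝ ∞ L) {x : ℝ → Conf N}
    (hx : ContDiffOn ℝ ∞ x (Icc a b)) {y : ℝ → Conf N} (hy : ContinuousOn y (Icc s s')) :
    ∫ t in s..s', elTower a b L x 0 t (y t) = ∑ i ∈ Finset.range (n + 1),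
      (-1) ^ i * ∫ t in s..s', partialTower a b L x i i t (y t) := by
  simp_rw [← intervalIntegral.integral_const_mul]
  rw [← intervalIntegral.integral_finsetSum]
  · congr 1
    ext1 t
    simp [elTower]
  · intro i _
    refine ContinuousOn.intervalIntegrable ?_ |>.const_mul _
    rw [uIcc_of_le hs]
    exact (((isTower_partialTower hab hL hx i).continuousOn i).mono has).clm_apply hy

theorem firstVariation_eq_integral_elTower {a b : ℝ} (hab : a < b) {L : Jet N n → ℝ}
    (hL : ContDiff ℝ ∞ L) {x : ℝ → Conf N} (hx : ContDiffOn ℝ ∞ x (Icc a b)) {y : ℝ → Conf N}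
    (hy : IsSmoothVariation a b y) :
    firstVariation a b L x y = ∫ t in a..b, elTower a b L x 0 t (y t) := by
  have hd : ∀ t, ContDiffAt ℝ ∞ y t := fun t => hy.smooth.contDiffAt
  have hty : IsTower (Icc a b) (fun j => iteratedDeriv j y) := isTower_iteratedDeriv fun t _ => hd t
  have hcont : ∀ i, Continuous (iteratedDeriv i y) := fun i =>
    hy.smooth.continuous_iteratedDeriv i (by exact_mod_cast le_top)
  have hz : ∀ i t, t ∉ Icc a b → iteratedDeriv i y t = 0 := by
    intro i t ht
    have h1 : y =ᶠ[𝓝 t] fun _ => 0 := by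
      filter_upwards [isClosed_Icc.isOpen_compl.mem_nhds ht] with s hs
      exact hy.zero_outside s hs
    simpa using (h1.iteratedDeriv i).eq_of_nhds
  -- Every derivative is continuous on `ℝ` and vanishes outside `[a, b]`, hence vanishes at the
  -- endpoints.
  have hza : ∀ i, iteratedDeriv i y a = 0 := by
    intro i
    have : EqOn (iteratedDeriv i y) (fun _ => 0) (closure (Iio a)) :=
      EqOn.closure (fun t ht => hz i t fun h => not_lt.2 h.1 ht) (hcont i) continuous_const
    exact this (by rw [closure_Iio]; exact self_mem_Iic)
  have hzb : ∀ i, iteratedDeriv i y b = 0 := by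
    intro i
    have : EqOn (iteratedDeriv i y) (fun _ => 0) (closure (Ioi b)) :=
      EqOn.closure (fun t ht => hz i t fun h => not_lt.2 h.2 ht) (hcont i) continuous_const
    exact this (by rw [closure_Ioi]; exact self_mem_Ici)
  rw [firstVariation_eq hab hL hx countable_empty (fun t _ => hd t)]
  · rw [integral_elTower hab.le subset_rfl hab hL hx hy.smooth.continuous.continuousOn]
    refine Finset.sum_congr rfl fun i _ => ?_
    rw [(isTower_partialTower hab hL hx i).integral_clm_iterate hab.le hty i 0
      fun r _ => ⟨hza r, hzb r⟩]
    simp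
  · intro i
    obtain ⟨C, hC⟩ := isCompact_Icc.exists_bound_of_continuousOn (s := Icc a b) (hcont i).continuousOn
    exact ⟨C, fun t ht _ => hC t ht⟩

end Parts

/-! ### Part (a): smooth variations -/

section Smooth

open MeasureTheory

variable {N n : ℕ}

/-- By Riesz representation, the normalized representing vector attains the norm. Nontriviality
supplies a unit vector when `A = 0`. -/
theorem exists_norm_eq_one_apply_eq_norm [Nontrivial (Conf N)] (A : Conf N →L[ℝ] ℝ) :
    ∃ v : Conf N, ‖v‖ = 1 ∧ A v = ‖A‖ := by
  by_cases hA : A = 0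
  · obtain ⟨v, hv⟩ := exists_norm_eq (Conf N) zero_le_one
    exact ⟨v, hv, by simp [hA]⟩
  · set w := (InnerProductSpace.toDual ℝ (Conf N)).symm A with hw
    have hnw : ‖w‖ = ‖A‖ := LinearIsometryEquiv.norm_map _ _
    have h0 : ‖w‖ ≠ 0 := by rw [hnw]; exact norm_ne_zero_iff.2 hA
    refine ⟨‖w‖⁻¹ • w, by rw [norm_smul, norm_inv, norm_norm, inv_mul_cancel₀ h0], ?_⟩
    have h1 : A w = ‖w‖ ^ 2 := by
      rw [← real_inner_self_eq_norm_sq, hw, InnerProductSpace.toDual_symm_apply]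
    rw [map_smul, h1, smul_eq_mul, ← hnw]
    field_simp

theorem abs_integral_clm_le {a b : ℝ} (hab : a ≤ b) {A : ℝ → Conf N →L[ℝ] ℝ} {y : ℝ → Conf N}
    {B : ℝ} (hA : ∀ᵐ t, t ∈ Ioc a b → ‖A t‖ ≤ B)
    (hy : IntervalIntegrable (fun t => ‖y t‖) volume a b) :
    |∫ t in a..b, A t (y t)| ≤ B * ∫ t in a..b, ‖y t‖ := by
  rw [← intervalIntegral.integral_const_mul, ← Real.norm_eq_abs]
  refine intervalIntegral.norm_integral_le_of_norm_le hab ?_ (hy.const_mul _)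
  filter_upwards [hA] with t ht h
  exact (ContinuousLinearMap.le_opNorm _ _).trans
    (mul_le_mul_of_nonneg_right (ht h) (norm_nonneg _))

theorem norm1_nonneg {a b : ℝ} (hab : a ≤ b) (y : ℝ → Conf N) : 0 ≤ norm1 a b y :=
  intervalIntegral.integral_nonneg hab fun _ _ => norm_nonneg _

theorem isKCritical_of_uniformBigO {a b : ℝ} (hab : a < b) {L : ℝ → Jet N n → ℝ}
    (hL : IsLagrangianFamily L) {x : ℝ → ℝ → Conf N} (hx : IsAdmissible a b x) {k : ℕ}
    (h : UniformBigO a b (fun h => eulerLagrange a b (L h) (x h)) (k + 1)) :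
    IsKCritical a b L k x := by
  obtain ⟨C, hC⟩ := h
  intro y hy
  refine IsBigO.of_bound C ?_
  filter_upwards [hC, self_mem_nhdsWithin] with h hh hpos
  have hpos : 0 < h := hpos
  rw [firstVariation_eq_integral_elTower hab (hL.smooth h hpos) (hx.smooth h hpos) (hy h hpos),
    elTower_zero, Real.norm_eq_abs, Real.norm_eq_abs,
    abs_of_nonneg (mul_nonneg (pow_nonneg hpos.le _) (norm1_nonneg hab.le _)), ← mul_assoc]
  exact abs_integral_clm_le hab.le
    (Eventually.of_forall fun t ht => hh t (Ioc_subset_Icc_self ht))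
    ((hy h hpos).smooth.continuous.norm.intervalIntegrable _ _)

/-- A localized smooth variation that detects the maximum of the Euler-Lagrange expression. -/
theorem exists_smoothVariation [Nontrivial (Conf N)] {a b : ℝ} (hab : a < b) {L : Jet N n → ℝ}
    (hL : ContDiff ℝ ∞ L) {x : ℝ → Conf N} (hx : ContDiffOn ℝ ∞ x (Icc a b)) :
    ∃ y, IsSmoothVariation a b y ∧ ((∀ t ∈ Icc a b, elTower a b L x 0 t = 0) ∨ 0 < norm1 a b y) ∧
      ∀ t ∈ Icc a b, ‖elTower a b L x 0 t‖ * norm1 a b y ≤ 2 * firstVariation a b L x y := by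
  have hc : ContinuousOn (elTower a b L x 0) (Icc a b) := (isTower_elTower hab hL hx).continuousOn 0
  by_cases hz : ∀ t ∈ Icc a b, elTower a b L x 0 t = 0
  · have h0 : IsSmoothVariation a b (fun _ => (0 : Conf N)) := ⟨contDiff_const, fun _ _ => rfl⟩
    refine ⟨fun _ => 0, h0, Or.inl hz, fun t ht => ?_⟩
    rw [firstVariation_eq_integral_elTower hab hL hx h0]
    simp [hz t ht]
  obtain ⟨t₀, ht₀, hmax⟩ := isCompact_Icc.exists_isMaxOn (nonempty_Icc.2 hab.le) hc.norm
  set M := ‖elTower a b L x 0 t₀‖ with hM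
  have hM' : ∀ t ∈ Icc a b, ‖elTower a b L x 0 t‖ ≤ M := fun t ht => hmax ht
  have hM0 : 0 < M := by
    by_contra! h
    exact hz fun t ht => norm_le_zero_iff.1 ((hM' t ht).trans h)
  -- The maximum may sit at an endpoint, where variations vanish; moving to an interior point costs
  -- less than a factor 2.
  obtain ⟨t₁, ht₁, hM1⟩ : ∃ t ∈ Ioo a b, M / 2 < ‖elTower a b L x 0 t‖ := by
    by_contra! h
    have h1 : closure (Ioo a b) = Icc a b := closure_Ioo hab.ne
    have := le_on_closure h (h1 ▸ hc.norm) continuousOn_const (h1 ▸ ht₀)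
    linarith
  obtain ⟨v, hv, hv1⟩ := exists_norm_eq_one_apply_eq_norm (elTower a b L x 0 t₁)
  have hcv : ContinuousAt (fun t => elTower a b L x 0 t v) t₁ :=
    (hc.continuousAt (Icc_mem_nhds ht₁.1 ht₁.2)).clm_apply continuousAt_const
  have hU : {t | t ∈ Ioo a b ∧ M / 2 < elTower a b L x 0 t v} ∈ 𝓝 t₁ :=
    inter_mem (Ioo_mem_nhds ht₁.1 ht₁.2) (hcv.eventually (lt_mem_nhds (by simpa only [hv1] using hM1)))
  -- No lower bound on the width of the bump is needed: smooth variations carry no uniform bound on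
  -- their derivatives.
  obtain ⟨φ, hsupp, -, hφ, hrange, hφ1⟩ := exists_contDiff_tsupport_subset (n := ⊤) hU
  have hφ0 : ∀ t, 0 ≤ φ t := fun t => (hrange (mem_range_self t)).1
  have hφz : ∀ t, φ t ≠ 0 → t ∈ Ioo a b ∧ M / 2 < elTower a b L x 0 t v :=
    fun t ht => hsupp (subset_tsupport _ ht)
  have hy : IsSmoothVariation a b (fun t => φ t • v) := by
    refine ⟨hφ.smul contDiff_const, fun t ht => ?_⟩
    by_contra h
    have : φ t ≠ 0 := fun h' => h (by simp [h'])
    exact ht (Ioo_subset_Icc_self (hφz t this).1)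
  have hn : norm1 a b (fun t => φ t • v) = ∫ t in a..b, φ t := by
    unfold norm1
    congr 1
    ext1 t
    rw [norm_smul, hv, mul_one, Real.norm_eq_abs, abs_of_nonneg (hφ0 t)]
  have hpos : 0 < norm1 a b (fun t => φ t • v) := by
    rw [hn]
    exact intervalIntegral.integral_pos hab hφ.continuous.continuousOn (fun t _ => hφ0 t)
      ⟨t₁, Ioo_subset_Icc_self ht₁, by rw [hφ1]; exact one_pos⟩
  refine ⟨_, hy, Or.inr hpos, fun t ht => ?_⟩
  have h1 : M / 2 * norm1 a b (fun t => φ t • v)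
      ≤ firstVariation a b L x (fun t => φ t • v) := by
    rw [firstVariation_eq_integral_elTower hab hL hx hy, hn,
      ← intervalIntegral.integral_const_mul]
    refine intervalIntegral.integral_mono_on hab.le
      ((hφ.continuous.intervalIntegrable _ _).const_mul _) ?_ fun s _ => ?_
    · apply ContinuousOn.intervalIntegrable
      rw [uIcc_of_le hab.le]
      exact hc.clm_apply (hφ.continuous.smul continuous_const).continuousOn
    · rw [map_smul, smul_eq_mul, mul_comm]
      by_cases hs : φ s = 0
      · simp [hs]
      · exact mul_le_mul_of_nonneg_left (hφz s hs).2.le (hφ0 s)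
  have := mul_le_mul_of_nonneg_right (hM' t ht) hpos.le
  linarith

/-- Choosing one detecting variation for every `h` gives a single family, so one constant from
criticality bounds the Euler-Lagrange expression for all small `h`. -/
theorem uniformBigO_of_isKCritical [Nontrivial (Conf N)] {a b : ℝ} (hab : a < b)
    {L : ℝ → Jet N n → ℝ} (hL : IsLagrangianFamily L) {x : ℝ → ℝ → Conf N}
    (hx : IsAdmissible a b x) {k : ℕ} (h : IsKCritical a b L k x) :
    UniformBigO a b (fun h => eulerLagrange a b (L h) (x h)) (k + 1) := by
  have H : ∀ h : ℝ, ∃ y, 0 < h → IsSmoothVariation a b y ∧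
      ((∀ t ∈ Icc a b, elTower a b (L h) (x h) 0 t = 0) ∨ 0 < norm1 a b y) ∧
      ∀ t ∈ Icc a b, ‖elTower a b (L h) (x h) 0 t‖ * norm1 a b y
        ≤ 2 * firstVariation a b (L h) (x h) y := by
    intro h
    by_cases hh : 0 < h
    · obtain ⟨y, hy⟩ := exists_smoothVariation hab (hL.smooth h hh) (hx.smooth h hh)
      exact ⟨y, fun _ => hy⟩
    · exact ⟨0, fun h' => absurd h' hh⟩
  choose y hy using H
  obtain ⟨C, hC⟩ := (h y fun h hh => (hy h hh).1).bound
  refine ⟨2 * |C|, ?_⟩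
  filter_upwards [hC, self_mem_nhdsWithin] with h hh hpos t ht
  have hpos : 0 < h := hpos
  obtain ⟨-, h1, h2⟩ := hy h hpos
  simp_rw [← elTower_zero]
  rcases h1 with h1 | h1
  · rw [h1 t ht, norm_zero]
    positivity
  · have h3 := h2 t ht
    rw [Real.norm_eq_abs, Real.norm_eq_abs, abs_of_nonneg (mul_nonneg (pow_nonneg hpos.le _) h1.le)]
      at hh
    have h4 := (le_abs_self _).trans hh
    have h5 : C * (h ^ (k + 1) * norm1 a b (y h)) ≤ |C| * (h ^ (k + 1) * norm1 a b (y h)) :=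
      mul_le_mul_of_nonneg_right (le_abs_self _) (by positivity)
    refine le_of_mul_le_mul_right ?_ h1
    linarith

/-- Covers `N = 0`, where there are no unit vectors to test with. -/
theorem uniformBigO_of_subsingleton [Subsingleton (Conf N)] (a b : ℝ)
    (f : ℝ → ℝ → Conf N →L[ℝ] ℝ) (p : ℕ) : UniformBigO a b f p := by
  refine ⟨0, Eventually.of_forall fun h t _ => ?_⟩
  have : f h t = 0 := by
    ext v
    simp [Subsingleton.elim v 0]
  simp [this]

end Smooth

/-! ### Part (c): discrete curves -/

section Discrete

variable {N : ℕ}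

theorem hasDerivAt_discAction {L : Conf N → Conf N → ℝ → ℝ} {h : ℝ}
    (hL : Differentiable ℝ (fun p : Conf N × Conf N => L p.1 p.2 h)) (n : ℕ) (x δx : ℕ → Conf N) :
    HasDerivAt (fun ε : ℝ => discAction L h n (fun j => x j + ε • δx j))
      (∑ j ∈ Finset.range n, h * (fderiv ℝ (fun q => L q (x (j + 1)) h) (x j) (δx j)
        + fderiv ℝ (fun q => L (x j) q h) (x (j + 1)) (δx (j + 1)))) 0 := by
  refine HasDerivAt.fun_sum fun j _ => HasDerivAt.const_mul h ?_
  have h1 : HasFDerivAt (fun p : Conf N × Conf N => L p.1 p.2 h) _ (x j, x (j + 1)) :=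
    (hL _).hasFDerivAt
  set A := fderiv ℝ (fun p : Conf N × Conf N => L p.1 p.2 h) (x j, x (j + 1))
  have h2 : fderiv ℝ (fun q => L q (x (j + 1)) h) (x j)
      = A.comp (ContinuousLinearMap.inl ℝ (Conf N) (Conf N)) :=
    (HasFDerivAt.comp (f := fun q => (q, x (j + 1)))
      (g := fun p : Conf N × Conf N => L p.1 p.2 h) (x j) h1
      (hasFDerivAt_prodMk_left (x j) (x (j + 1)))).fderiv
  have h3 : fderiv ℝ (fun q => L (x j) q h) (x (j + 1))
      = A.comp (ContinuousLinearMap.inr ℝ (Conf N) (Conf N)) :=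
    (HasFDerivAt.comp (f := fun q => (x j, q))
      (g := fun p : Conf N × Conf N => L p.1 p.2 h) (x (j + 1)) h1
      (hasFDerivAt_prodMk_right (x j) (x (j + 1)))).fderiv
  have h4 : HasDerivAt (fun ε : ℝ => (x j + ε • δx j, x (j + 1) + ε • δx (j + 1)))
      (δx j, δx (j + 1)) 0 := by
    refine HasDerivAt.prodMk ?_ ?_
    · simpa using ((hasDerivAt_id (0 : ℝ)).smul_const (δx j)).const_add (x j)
    · simpa using ((hasDerivAt_id (0 : ℝ)).smul_const (δx (j + 1))).const_add (x (j + 1))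
  have h5 := HasFDerivAt.comp_hasDerivAt_of_eq (0 : ℝ) h1 h4 (by simp)
  rw [h2, h3, ContinuousLinearMap.comp_apply, ContinuousLinearMap.comp_apply, ← map_add]
  simp only [ContinuousLinearMap.inl_apply, ContinuousLinearMap.inr_apply, Prod.mk_add_mk,
    add_zero, zero_add]
  exact h5

/-- Summation by parts: the `D₁` terms are shifted by one index against the `D₂` terms, and the two
unmatched terms sit at the endpoints. The index `j` stands for the interior point `j + 1`. -/
theorem discFirstVariation_succ {L : Conf N → Conf N → ℝ → ℝ} {h : ℝ}
    (hL : Differentiable ℝ (fun p : Conf N × Conf N => L p.1 p.2 h)) (m : ℕ) (x δx : ℕ → Conf N)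
    (h0 : δx 0 = 0) (h1 : δx (m + 1) = 0) :
    discFirstVariation L h (m + 1) x δx = ∑ j ∈ Finset.range m,
      h * discEulerLagrange L h (x j) (x (j + 1)) (x (j + 2)) (δx (j + 1)) := by
  rw [discFirstVariation, (hasDerivAt_discAction hL _ x δx).deriv]
  simp_rw [mul_add]
  rw [Finset.sum_add_distrib, Finset.sum_range_succ', Finset.sum_range_succ _ m, h0, h1]
  simp only [map_zero, mul_zero, add_zero]
  rw [← Finset.sum_add_distrib]
  refine Finset.sum_congr rfl fun j _ => ?_
  rw [discEulerLagrange, _root_.add_apply]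
  ring

theorem discNorm_succ (h : ℝ) (m : ℕ) (δx : ℕ → Conf N) (h0 : δx 0 = 0) (h1 : δx (m + 1) = 0) :
    discNorm h (m + 1) δx = ∑ j ∈ Finset.range m, h * ‖δx (j + 1)‖ := by
  rw [discNorm, Finset.sum_range_succ', Finset.sum_range_succ, h0, h1]
  simp

theorem discNorm_nonneg {h : ℝ} (hh : 0 < h) (n : ℕ) (δx : ℕ → Conf N) : 0 ≤ discNorm h n δx :=
  Finset.sum_nonneg fun _ _ => by positivity

theorem isDiscKCritical_of_bound {L : Conf N → Conf N → ℝ → ℝ}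
    (hL : ∀ h : ℝ, 0 < h → Differentiable ℝ (fun p : Conf N × Conf N => L p.1 p.2 h))
    {n : ℝ → ℕ} {x : ℝ → ℕ → Conf N} {k : ℕ} {C : ℝ}
    (hC : ∀ᶠ h : ℝ in 𝓝[>] 0, ∀ j : ℕ, 1 ≤ j → j < n h →
      ‖discEulerLagrange L h (x h (j - 1)) (x h j) (x h (j + 1))‖ ≤ C * h ^ (k + 1)) :
    IsDiscKCritical L k n x := by
  intro δx hδ
  refine IsBigO.of_bound C ?_
  filter_upwards [hC, self_mem_nhdsWithin] with h hh hpos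
  have hpos : 0 < h := hpos
  obtain ⟨h0, h1⟩ := hδ h hpos
  rcases hn : n h with _ | m
  · rw [hn] at h1
    simp [discFirstVariation, discAction, discNorm, h0]
  · rw [hn] at h1 hh
    rw [discFirstVariation_succ (hL h hpos) m _ _ h0 h1, Real.norm_eq_abs, Real.norm_eq_abs,
      abs_of_nonneg (mul_nonneg (pow_nonneg hpos.le _) (discNorm_nonneg hpos _ _)),
      discNorm_succ h m _ h0 h1, Finset.mul_sum, Finset.mul_sum]
    refine (Finset.abs_sum_le_sum_abs _ _).trans (Finset.sum_le_sum fun j hj => ?_)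
    rw [abs_mul, abs_of_pos hpos]
    have h2 := hh (j + 1) (by omega) (by simpa using hj)
    rw [Nat.add_sub_cancel] at h2
    have h3 := ((discEulerLagrange L h (x h j) (x h (j + 1)) (x h (j + 2))).le_opNorm
      (δx h (j + 1))).trans (mul_le_mul_of_nonneg_right h2 (norm_nonneg _))
    rw [Real.norm_eq_abs] at h3
    calc _ ≤ h * (C * h ^ (k + 1) * ‖δx h (j + 1)‖) := mul_le_mul_of_nonneg_left h3 hpos.le
      _ = _ := by ring

theorem exists_discVariation [Nontrivial (Conf N)] {L : Conf N → Conf N → ℝ → ℝ} {h : ℝ}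
    (hpos : 0 < h) (hL : Differentiable ℝ (fun p : Conf N × Conf N => L p.1 p.2 h)) (n : ℕ)
    (x : ℕ → Conf N) :
    ∃ δx : ℕ → Conf N, δx 0 = 0 ∧ δx n = 0 ∧ ∀ j : ℕ, 1 ≤ j → j < n →
      0 < discNorm h n δx ∧ ‖discEulerLagrange L h (x (j - 1)) (x j) (x (j + 1))‖ *
        discNorm h n δx ≤ discFirstVariation L h n x δx := by
  by_cases hn : n < 2
  · exact ⟨fun _ => 0, rfl, rfl, fun j h1 h2 => by omega⟩
  obtain ⟨m, rfl⟩ : ∃ m, n = m + 1 := ⟨n - 1, by omega⟩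
  set A := fun j => discEulerLagrange L h (x j) (x (j + 1)) (x (j + 2)) with hA
  obtain ⟨j₀, hj₀, hmax⟩ := (Finset.range m).exists_max_image (fun j => ‖A j‖)
    ⟨0, Finset.mem_range.2 (by omega)⟩
  have hj₀m : j₀ < m := Finset.mem_range.1 hj₀
  obtain ⟨v, hv, hv1⟩ := exists_norm_eq_one_apply_eq_norm (A j₀)
  -- `A` is indexed by the left neighbour, hence the shift. The norm of this variation is exactly
  -- `h`, the factor also carried by the first variation.
  set δ : ℕ → Conf N := fun j => if j = j₀ + 1 then v else 0 with hδ
  have h0 : δ 0 = 0 := by simp [hδ]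
  have h1 : δ (m + 1) = 0 := if_neg (by omega)
  have hnorm : discNorm h (m + 1) δ = h := by
    rw [discNorm_succ h m δ h0 h1, Finset.sum_eq_single j₀]
    · simp [hδ, hv]
    · intro j _ hj
      simp [hδ, hj]
    · exact fun h' => absurd hj₀ h'
  have hvar : discFirstVariation L h (m + 1) x δ = h * ‖A j₀‖ := by
    rw [discFirstVariation_succ hL m x δ h0 h1, Finset.sum_eq_single j₀]
    · rw [← hv1]
      simp only [hδ, if_true, hA]
    · intro j _ hj
      simp [hδ, hj]
    · exact fun h' => absurd hj₀ h'
  refine ⟨δ, h0, h1, fun j hj1 hj2 => ?_⟩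
  rw [hnorm, hvar, mul_comm]
  refine ⟨hpos, mul_le_mul_of_nonneg_left ?_ hpos.le⟩
  obtain ⟨i, rfl⟩ : ∃ i, j = i + 1 := ⟨j - 1, by omega⟩
  exact hmax i (Finset.mem_range.2 (by omega))

theorem isDiscKCritical_iff {L : Conf N → Conf N → ℝ → ℝ}
    (hL : ∀ h : ℝ, 0 < h → Differentiable ℝ (fun p : Conf N × Conf N => L p.1 p.2 h))
    (n : ℝ → ℕ) (x : ℝ → ℕ → Conf N) (k : ℕ) :
    IsDiscKCritical L k n x ↔ ∃ C : ℝ, ∀ᶠ h : ℝ in 𝓝[>] 0, ∀ j : ℕ, 1 ≤ j → j < n h →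
      ‖discEulerLagrange L h (x h (j - 1)) (x h j) (x h (j + 1))‖ ≤ C * h ^ (k + 1) := by
  refine ⟨fun H => ?_, fun ⟨C, hC⟩ => isDiscKCritical_of_bound hL hC⟩
  rcases subsingleton_or_nontrivial (Conf N) with hN | hN
  · refine ⟨0, Eventually.of_forall fun h j _ _ => ?_⟩
    have : discEulerLagrange L h (x h (j - 1)) (x h j) (x h (j + 1)) = 0 := by
      ext v
      simp [Subsingleton.elim v 0]
    simp [this]
  have H' : ∀ h : ℝ, ∃ δx : ℕ → Conf N, 0 < h → δx 0 = 0 ∧ δx (n h) = 0 ∧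
      ∀ j : ℕ, 1 ≤ j → j < n h → 0 < discNorm h (n h) δx ∧
        ‖discEulerLagrange L h (x h (j - 1)) (x h j) (x h (j + 1))‖ * discNorm h (n h) δx
          ≤ discFirstVariation L h (n h) (x h) δx := by
    intro h
    by_cases hh : 0 < h
    · obtain ⟨δ, hδ⟩ := exists_discVariation hh (hL h hh) (n h) (x h)
      exact ⟨δ, fun _ => hδ⟩
    · exact ⟨0, fun h' => absurd h' hh⟩
  choose δ hδ using H'
  obtain ⟨C, hC⟩ := (H δ fun h hh => ⟨(hδ h hh).1, (hδ h hh).2.1⟩).bound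
  refine ⟨C, ?_⟩
  filter_upwards [hC, self_mem_nhdsWithin] with h hh hpos j hj1 hj2
  have hpos : 0 < h := hpos
  obtain ⟨h1, h2⟩ := (hδ h hpos).2.2 j hj1 hj2
  rw [Real.norm_eq_abs, Real.norm_eq_abs, abs_of_nonneg (mul_nonneg (pow_nonneg hpos.le _) h1.le)]
    at hh
  refine le_of_mul_le_mul_right ?_ h1
  rw [mul_assoc]
  exact h2.trans ((le_abs_self _).trans hh)

end Discrete

/-! ### Inverse estimate for variations with kinks on a mesh -/

section Mesh

open MeasureTheory

variable {N n : ℕ}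

/-- The bi-infinite mesh through `t₀` with step `h`. -/
def mesh (t₀ h : ℝ) : Set ℝ := range fun j : ℤ => t₀ + j * h

theorem countable_mesh (t₀ h : ℝ) : (mesh t₀ h).Countable := countable_range _

theorem IsMeshedVariation.exists_mesh {a b h : ℝ} {y : ℝ → Conf N}
    (hy : IsMeshedVariation a b h y) : ∃ t₀, ∀ t, t ∉ mesh t₀ h → ContDiffAt ℝ ∞ y t := by
  obtain ⟨t₀, -, H⟩ := hy.smooth_off_mesh
  refine ⟨t₀, fun t ht => (H t).resolve_left ?_⟩
  rintro ⟨-, j, hj⟩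
  exact ht ⟨j, by push_cast; linarith⟩

/-- Off the mesh, a segment of length `h / 4` in one of the two directions avoids the mesh. -/
theorem exists_segment_disjoint_mesh {t₀ h t : ℝ} (hh : 0 < h) (ht : t ∉ mesh t₀ h) :
    ∃ η : ℝ, (η = h / 4 ∨ η = -(h / 4)) ∧ ∀ s ∈ Icc (0 : ℝ) 1, t + η * s ∉ mesh t₀ h := by
  set u := (t - t₀) / h with hu
  have htu : t = t₀ + u * h := by rw [hu]; field_simp; ring
  have h0 : (⌊u⌋ : ℝ) ≠ u := fun h' => ht ⟨⌊u⌋, by simp only [h', htu]⟩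
  have h1 : (⌊u⌋ : ℝ) < u := lt_of_le_of_ne (Int.floor_le u) h0
  have h2 : u < ⌊u⌋ + 1 := Int.lt_floor_add_one u
  have key : ∀ w : ℝ, (⌊u⌋ : ℝ) < w → w < ⌊u⌋ + 1 → t₀ + w * h ∉ mesh t₀ h := by
    rintro w hw1 hw2 ⟨j, hj⟩
    have hj' : (j : ℝ) = w := by
      have : (j : ℝ) * h = w * h := by simpa using hj
      exact mul_right_cancel₀ hh.ne' this
    rw [← hj'] at hw1 hw2
    have h3 : ⌊u⌋ < j := by exact_mod_cast hw1
    have h4 : j < ⌊u⌋ + 1 := by exact_mod_cast hw2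
    omega
  -- A point in the left half of its mesh cell moves right, one in the right half moves left; a
  -- quarter cell then stays strictly inside.
  rcases lt_or_ge u (⌊u⌋ + 1 / 2) with h3 | h3
  · refine ⟨h / 4, Or.inl rfl, fun s hs => ?_⟩
    rw [show t + h / 4 * s = t₀ + (u + s / 4) * h by linear_combination htu]
    exact key (u + s / 4) (by linarith [hs.1]) (by linarith [hs.2])
  · refine ⟨-(h / 4), Or.inr rfl, fun s hs => ?_⟩
    rw [show t + -(h / 4) * s = t₀ + (u - s / 4) * h by linear_combination htu]
    exact key (u - s / 4) (by linarith [hs.2]) (by linarith [hs.1])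

theorem integral_norm_translate_le {a b : ℝ} (hab : a ≤ b) {y : ℝ → Conf N} (hy : Continuous y)
    (hz : ∀ t, t ∉ Icc a b → y t = 0) (c : ℝ) : ∫ t in a..b, ‖y (t + c)‖ ≤ norm1 a b y := by
  have hint : Integrable (fun t => ‖y t‖) :=
    (hy.integrable_of_hasCompactSupport (HasCompactSupport.intro isCompact_Icc hz)).norm
  have h1 : norm1 a b y = ∫ t, ‖y t‖ := by
    rw [norm1, intervalIntegral.integral_of_le hab, ← integral_Icc_eq_integral_Ioc]
    exact setIntegral_eq_integral_of_forall_compl_eq_zero fun t ht => by simp [hz t ht]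
  rw [h1, intervalIntegral.integral_comp_add_right (fun t => ‖y t‖) c,
    intervalIntegral.integral_of_le (by linarith)]
  exact setIntegral_le_integral hint (Eventually.of_forall fun t => norm_nonneg _)

theorem continuous_integral_translate {y : ℝ → Conf N} (hy : Continuous y) (c : ℝ) :
    Continuous fun t => ∫ s in (0 : ℝ)..1, ‖y (t + c * s)‖ := by
  apply intervalIntegral.continuous_parametric_intervalIntegral_of_continuous'
  unfold Function.uncurry
  fun_prop

/-- By Fubini, an average of translates is no larger in `L¹` than the function itself, since `y`
vanishes outside `[a, b]`. -/
theorem integral_integral_norm_translate_le {a b : ℝ} (hab : a ≤ b) {y : ℝ → Conf N}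
    (hy : Continuous y) (hz : ∀ t, t ∉ Icc a b → y t = 0) (c : ℝ) :
    ∫ t in a..b, ∫ s in (0 : ℝ)..1, ‖y (t + c * s)‖ ≤ norm1 a b y := by
  have hc : Continuous (Function.uncurry fun t s : ℝ => ‖y (t + c * s)‖) := by
    unfold Function.uncurry
    fun_prop
  rw [intervalIntegral_intervalIntegral_swap]
  · have h1 : ∫ s in (0 : ℝ)..1, ∫ t in a..b, ‖y (t + c * s)‖ ≤ ∫ _ in (0 : ℝ)..1, norm1 a b y := by
      refine intervalIntegral.integral_mono_on zero_le_one ?_ (by simp) fun s _ =>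
        integral_norm_translate_le hab hy hz (c * s)
      apply Continuous.intervalIntegrable
      apply intervalIntegral.continuous_parametric_intervalIntegral_of_continuous'
      unfold Function.uncurry
      fun_prop
    simpa using h1
  · exact (hc.continuousOn.integrableOn_compact (isCompact_uIcc.prod isCompact_uIcc)).mono_set
      (prod_mono uIoc_subset_uIcc uIoc_subset_uIcc)

/-- Inverse estimate: the derivatives of a meshed variation cost at most a factor `1 / h` each, up
to an error governed by a derivative of higher order. -/
theorem exists_integral_norm_deriv_le {a b : ℝ} (hab : a < b) {i M : ℕ} (hi : i < M) :
    ∃ K : ℝ, 0 ≤ K ∧ ∀ (h B : ℝ) (y : ℝ → Conf N), 0 < h → IsMeshedVariation a b h y →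
      (∀ j, ∃ C, ∀ t ∈ Icc a b, ContDiffAt ℝ ∞ y t → ‖iteratedDeriv j y t‖ ≤ C) →
      (∀ t ∈ Icc a b, ContDiffAt ℝ ∞ y t → ‖iteratedDeriv M y t‖ ≤ B) →
        h ^ i * ∫ t in a..b, ‖iteratedDeriv i y t‖ ≤ K * (norm1 a b y + B * h ^ M) := by
  obtain ⟨K, hK, H⟩ := exists_norm_deriv_le (α := 0) (β := 1) le_rfl one_pos le_rfl M hi
  refine ⟨4 ^ i * K * (2 + (b - a)), by have := sub_pos.2 hab; positivity, ?_⟩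
  intro h B y hh hy hbd hB
  obtain ⟨t₀, hsm⟩ := hy.exists_mesh
  have hZ := countable_mesh t₀ h
  have hB0 : 0 ≤ B := by
    obtain ⟨t₁, h1, h2⟩ : ∃ t ∈ Icc a b, ContDiffAt ℝ ∞ y t := by
      refine ⟨a, left_mem_Icc.2 hab.le, ?_⟩
      obtain ⟨t₁, -, H'⟩ := hy.smooth_off_mesh
      exact (H' a).resolve_left fun h' => lt_irrefl _ h'.1.1
    exact (norm_nonneg _).trans (hB t₁ h1 h2)
  -- The segments of length `h / 4` may leave `[a, b]`; there the variation is zero and the bound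
  -- persists.
  have hB' : ∀ t, ContDiffAt ℝ ∞ y t → ‖iteratedDeriv M y t‖ ≤ B := by
    intro t ht
    by_cases htI : t ∈ Icc a b
    · exact hB t htI ht
    · have h1 : y =ᶠ[𝓝 t] fun _ => 0 := by
        filter_upwards [isClosed_Icc.isOpen_compl.mem_nhds htI] with s hs
        exact hy.zero_outside s hs
      have h2 := (h1.iteratedDeriv M).eq_of_nhds
      simp only [iteratedDeriv_fun_const_zero] at h2
      rw [h2, norm_zero]
      exact hB0
  set I : ℝ → ℝ → ℝ := fun c t => ∫ s in (0 : ℝ)..1, ‖y (t + c * s)‖ with hI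
  have hI0 : ∀ c t, 0 ≤ I c t := fun c t =>
    intervalIntegral.integral_nonneg zero_le_one fun _ _ => norm_nonneg _
  have hIc : ∀ c, Continuous (I c) := fun c => continuous_integral_translate hy.continuous c
  -- The direction of the free segment depends on `t`. Adding the averages over both directions
  -- gives a bound that is continuous in `t` and can be integrated.
  have hpt : ∀ t, t ∉ mesh t₀ h → (h / 4) ^ i * ‖iteratedDeriv i y t‖
      ≤ K * (I (h / 4) t + I (-(h / 4)) t + B * h ^ M) := by
    intro t ht
    obtain ⟨η, hη, hseg⟩ := exists_segment_disjoint_mesh hh ht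
    have hηa : |η| = h / 4 := by
      rcases hη with rfl | rfl
      · exact abs_of_pos (by linarith)
      · rw [abs_neg]
        exact abs_of_pos (by linarith)
    have hT : IsTower (mesh t₀ h)ᶜ (fun j => iteratedDeriv j y) :=
      isTower_iteratedDeriv fun s hs => hsm s hs
    have hg := hT.comp_affine η t (T := Icc 0 1) hseg
    have h1 := H (Conf N) _ hg (B * h ^ M) (fun s hs => by
      rw [norm_smul, norm_pow, Real.norm_eq_abs, hηa, mul_comm]
      refine mul_le_mul (hB' _ (hsm _ (hseg s hs))) ?_ (by positivity) hB0
      exact pow_le_pow_left₀ (by positivity) (by linarith) _)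
    simp only [pow_zero, one_smul, mul_zero, add_zero, norm_smul, norm_pow, Real.norm_eq_abs, hηa,
      iteratedDeriv_zero] at h1
    refine h1.trans (mul_le_mul_of_nonneg_left ?_ hK)
    refine add_le_add_left ?_ _
    rcases hη with rfl | rfl
    · exact le_add_of_nonneg_right (hI0 _ _)
    · exact le_add_of_nonneg_left (hI0 _ _)
  obtain ⟨Ci, hCi⟩ := hbd i
  have hint : IntervalIntegrable (fun t => ‖iteratedDeriv i y t‖) volume a b :=
    (intervalIntegrable_iteratedDeriv hab.le hZ hsm fun t h1 h2 => hCi t h1 (hsm t h2)).norm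
  have h2 : (h / 4) ^ i * ∫ t in a..b, ‖iteratedDeriv i y t‖
      ≤ ∫ t in a..b, K * (I (h / 4) t + I (-(h / 4)) t + B * h ^ M) := by
    rw [← intervalIntegral.integral_const_mul]
    refine intervalIntegral.integral_mono_ae hab.le (hint.const_mul _) ?_ ?_
    · apply Continuous.intervalIntegrable
      have := hIc (h / 4)
      have := hIc (-(h / 4))
      fun_prop
    · filter_upwards [measure_eq_zero_iff_ae_notMem.1 (hZ.measure_zero volume)] with t ht
      exact hpt t ht
  have h3 : ∫ t in a..b, K * (I (h / 4) t + I (-(h / 4)) t + B * h ^ M)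
      ≤ K * (2 * norm1 a b y + (b - a) * (B * h ^ M)) := by
    rw [intervalIntegral.integral_const_mul]
    refine mul_le_mul_of_nonneg_left ?_ hK
    have e1 : IntervalIntegrable (fun t => I (h / 4) t + I (-(h / 4)) t) volume a b :=
      ((hIc _).add (hIc _)).intervalIntegrable _ _
    rw [intervalIntegral.integral_add e1 (continuous_const.intervalIntegrable _ _),
      intervalIntegral.integral_add ((hIc _).intervalIntegrable _ _)
      ((hIc _).intervalIntegrable _ _), intervalIntegral.integral_const, smul_eq_mul]
    have h4 := integral_integral_norm_translate_le hab.le hy.continuous hy.zero_outside (h / 4)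
    have h5 := integral_integral_norm_translate_le hab.le hy.continuous hy.zero_outside (-(h / 4))
    simp only [hI]
    linarith
  have h6 : h ^ i * ∫ t in a..b, ‖iteratedDeriv i y t‖
      = 4 ^ i * ((h / 4) ^ i * ∫ t in a..b, ‖iteratedDeriv i y t‖) := by
    rw [div_pow]
    field_simp
  rw [h6, mul_assoc, mul_assoc]
  refine mul_le_mul_of_nonneg_left ((h2.trans h3).trans ?_) (by positivity)
  refine mul_le_mul_of_nonneg_left ?_ hK
  have h7 := norm1_nonneg hab.le y
  have h8 : 0 ≤ B * h ^ M := by positivity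
  have := sub_pos.2 hab
  nlinarith

/-- Here the finite-order hypothesis is used: the Taylor remainder `B h^M` must be dominated by
`‖δx_h‖₁`. -/
theorem IsMeshedVariationFamily.integral_norm_deriv_le {a b : ℝ} (hab : a < b)
    {δx : ℝ → ℝ → Conf N} (hδ : IsMeshedVariationFamily a b δx) (i : ℕ) :
    ∃ K : ℝ, ∀ᶠ h : ℝ in 𝓝[>] 0,
      h ^ i * ∫ t in a..b, ‖iteratedDeriv i (δx h) t‖ ≤ K * norm1 a b (δx h) := by
  obtain ⟨hmax, hmax0, hbd⟩ := hδ.admissible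
  obtain ⟨m, hm⟩ := hδ.finite_order
  obtain ⟨D, hD0, hD⟩ := hm.exists_nonneg
  -- `M` must exceed `i`, the order estimated, and be at least `m`, so that `h ^ M ≤ h ^ m =
  -- O(‖δx_h‖₁)`.
  obtain ⟨K, hK, H⟩ := exists_integral_norm_deriv_le (N := N) hab (i := i) (M := i + 1 + m)
    (by omega)
  obtain ⟨B, hB⟩ := hbd (i + 1 + m)
  refine ⟨K * (1 + |B| * D), ?_⟩
  filter_upwards [hD.bound, Ioc_mem_nhdsGT hmax0, Ioc_mem_nhdsGT (zero_lt_one' ℝ)]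
    with h h1 h2 h3
  have h4 := H h |B| (δx h) h2.1 (hδ.meshed h h2.1)
    (fun j => (hbd j).imp fun C hC => hC h h2) fun t ht hs => (hB h h2 t ht hs).trans (le_abs_self _)
  refine h4.trans ?_
  rw [mul_assoc]
  refine mul_le_mul_of_nonneg_left ?_ hK
  rw [Real.norm_eq_abs, Real.norm_eq_abs, abs_of_nonneg (pow_nonneg h2.1.le _),
    abs_of_nonneg (norm1_nonneg hab.le _)] at h1
  have h5 : h ^ (i + 1 + m) ≤ h ^ m := pow_le_pow_of_le_one h3.1.le h3.2 (by omega)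
  have h6 := mul_le_mul_of_nonneg_left (h5.trans h1) (abs_nonneg B)
  linarith

end Mesh

/-! ### Interpolation for families depending on `h` -/

section Interpolation

variable {E : Type} [NormedAddCommGroup E] [NormedSpace ℝ E] [CompleteSpace E]

/-- Uniform interpolation: a family that is `O(h^p)` away from the endpoints and has uniformly
bounded derivatives satisfies `f_h^(j) = O(h^(p-j))` on the whole interval. -/
theorem exists_bound_deriv_of_interior {a b : ℝ} (hab : a < b) {f : ℝ → ℕ → ℝ → E}
    (hf : ∀ h : ℝ, 0 < h → IsTower (Icc a b) (f h))
    (hbd : ∃ hmax : ℝ, 0 < hmax ∧ ∀ m : ℕ, ∃ C : ℝ, ∀ h ∈ Ioc 0 hmax, ∀ t ∈ Icc a b,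
      ‖f h m t‖ ≤ C) {p j : ℕ} (hj : j ≤ p)
    (hint : ∃ C : ℝ, ∀ᶠ h : ℝ in 𝓝[>] 0, ∀ t ∈ Icc (a + 2 * h) (b - 2 * h),
      ‖f h 0 t‖ ≤ C * h ^ p) :
    ∃ C : ℝ, ∀ᶠ h : ℝ in 𝓝[>] 0, ∀ t ∈ Icc a b, ‖f h j t‖ ≤ C * h ^ (p - j) := by
  obtain ⟨hmax, hmax0, hbd⟩ := hbd
  obtain ⟨B, hB⟩ := hbd (p + 1)
  obtain ⟨A, hA⟩ := hint
  -- Order `p + 1` admits `j = p`, and its remainder `h ^ (p + 1)` is below the target `h ^ p`.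
  obtain ⟨K, hK, H⟩ := exists_norm_deriv_le_of_interior (p + 1) (j := j) (by omega)
  refine ⟨K * (A + |B|), ?_⟩
  have hab' : 0 < (b - a) / 12 := by linarith
  filter_upwards [hA, Ioc_mem_nhdsGT hmax0, Ioc_mem_nhdsGT (zero_lt_one' ℝ), Ioc_mem_nhdsGT hab']
    with h h1 h2 h3 h4 t ht
  have h5 := H E a b h (A * h ^ p) |B| (f h) h2.1 (by linarith [h4.2]) (hf h h2.1)
    (fun t ht => (hB h h2 t ht).trans (le_abs_self _)) h1 t ht
  have h6 : |B| * h ^ (p + 1) ≤ |B| * h ^ p :=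
    mul_le_mul_of_nonneg_left (pow_le_pow_of_le_one h3.1.le h3.2 (by omega)) (abs_nonneg _)
  have h7 : h ^ j * ‖f h j t‖ ≤ h ^ j * (K * (A + |B|) * h ^ (p - j)) := by
    have h8 : h ^ p = h ^ j * h ^ (p - j) := by rw [← pow_add, Nat.add_sub_cancel' hj]
    calc h ^ j * ‖f h j t‖ ≤ K * (A * h ^ p + |B| * h ^ (p + 1)) := h5
      _ ≤ K * (A * h ^ p + |B| * h ^ p) := by gcongr
      _ = _ := by rw [h8]; ring
  exact le_of_mul_le_mul_left h7 (pow_pos h2.1 j)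

end Interpolation

/-! ### Part (b): sufficiency -/

section MeshedSufficient

open MeasureTheory

variable {N n : ℕ}

/-- The error made when `∫ ∂L/∂x^(i) y^(i)` is integrated by parts `i` times without boundary
terms. -/
def partsError (a b : ℝ) (L : Jet N n → ℝ) (x y : ℝ → Conf N) (i : ℕ) : ℝ :=
  (∫ t in a..b, partialTower a b L x i 0 t (iteratedDeriv i y t))
    - (-1) ^ i * ∫ t in a..b, partialTower a b L x i i t (y t)

theorem IsMeshedVariation.firstVariation_eq {a b h : ℝ} (hab : a < b)
    {L : Jet N n → ℝ} (hL : ContDiff ℝ ∞ L) {x : ℝ → Conf N} (hx : ContDiffOn ℝ ∞ x (Icc a b))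
    {y : ℝ → Conf N} (hy : IsMeshedVariation a b h y)
    (hbd : ∀ j, ∃ C, ∀ t ∈ Icc a b, ContDiffAt ℝ ∞ y t → ‖iteratedDeriv j y t‖ ≤ C) :
    firstVariation a b L x y = (∫ t in a..b, elTower a b L x 0 t (y t))
      + ∑ i ∈ Finset.range (n + 1), partsError a b L x y i := by
  obtain ⟨t₀, hsm⟩ := hy.exists_mesh
  rw [KCrit.firstVariation_eq hab hL hx (countable_mesh t₀ h) hsm
    (fun i => (hbd i).imp fun C hC t h1 h2 => hC t h1 (hsm t h2)),
    integral_elTower hab.le subset_rfl hab hL hx hy.continuous.continuousOn]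
  simp [partsError, Finset.sum_sub_distrib]

theorem IsMeshedVariation.eq_zero_left {a b h : ℝ} {y : ℝ → Conf N}
    (hy : IsMeshedVariation a b h y) : y a = 0 := by
  have : EqOn y (fun _ => 0) (closure (Iio a)) :=
    EqOn.closure (fun t ht => hy.zero_outside t fun h => not_lt.2 h.1 ht) hy.continuous
      continuous_const
  exact this (by rw [closure_Iio]; exact self_mem_Iic)

theorem IsMeshedVariation.eq_zero_right {a b h : ℝ} {y : ℝ → Conf N}
    (hy : IsMeshedVariation a b h y) : y b = 0 := by
  have : EqOn y (fun _ => 0) (closure (Ioi b)) :=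
    EqOn.closure (fun t ht => hy.zero_outside t fun h => not_lt.2 h.2 ht) hy.continuous
      continuous_const
  exact this (by rw [closure_Ioi]; exact self_mem_Ici)

/-- One integration by parts needs only continuity and differentiability off a countable set, so
kinks are invisible up to order 1. This is why the extra conditions start at `ℓ = 2`. -/
theorem IsMeshedVariation.partsError_eq_zero {a b h : ℝ} (hab : a < b)
    {L : Jet N n → ℝ} (hL : ContDiff ℝ ∞ L) {x : ℝ → Conf N} (hx : ContDiffOn ℝ ∞ x (Icc a b))
    {y : ℝ → Conf N} (hy : IsMeshedVariation a b h y)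
    (hbd : ∀ j, ∃ C, ∀ t ∈ Icc a b, ContDiffAt ℝ ∞ y t → ‖iteratedDeriv j y t‖ ≤ C) {i : ℕ}
    (hi : i < 2) : partsError a b L x y i = 0 := by
  interval_cases i
  · simp [partsError]
  obtain ⟨t₀, hsm⟩ := hy.exists_mesh
  obtain ⟨C, hC⟩ := hbd 1
  have hT := isTower_partialTower hab hL hx 1
  have h1 := intervalIntegrable_clm_iteratedDeriv hab.le (countable_mesh t₀ h) hsm
    (fun t h1 h2 => hC t h1 (hsm t h2)) (hT.continuousOn 0)
  have h2 : IntervalIntegrable (fun t => partialTower a b L x 1 1 t (y t)) volume a b := by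
    apply ContinuousOn.intervalIntegrable
    rw [uIcc_of_le hab.le]
    exact (hT.continuousOn 1).clm_apply hy.continuous.continuousOn
  have h3 : ∫ t in a..b, (partialTower a b L x 1 1 t (y t)
      + partialTower a b L x 1 0 t (iteratedDeriv 1 y t)) = 0 := by
    have := integral_eq_of_hasDerivAt_off_countable_of_le
      (fun t => partialTower a b L x 1 0 t (y t)) _ hab.le (countable_mesh t₀ h)
      ((hT.continuousOn 0).clm_apply hy.continuous.continuousOn) (fun t ht =>
        ((hT 0 t (Ioo_subset_Icc_self ht.1)).hasDerivAt (Icc_mem_nhds ht.1.1 ht.1.2)).clm_apply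
          (by simpa using hasDerivAt_iteratedDeriv (hsm t ht.2) 0)) (h2.add h1)
    rw [hy.eq_zero_left, hy.eq_zero_right] at this
    simpa using this
  rw [intervalIntegral.integral_add h2 h1] at h3
  rw [partsError]
  linarith

/-- Where `∂L/∂x^(i)` is small, integration by parts over the mesh produces a small error. -/
theorem exists_bound_partsError {a b : ℝ} (hab : a < b) {L : ℝ → Jet N n → ℝ}
    (hL : IsLagrangianFamily L) {x : ℝ → ℝ → Conf N} (hx : IsAdmissible a b x) {k i : ℕ}
    (hi : UniformBigO a b (fun h => partialAlong a b (L h) (x h) i) (k + i + 1))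
    {δx : ℝ → ℝ → Conf N} (hδ : IsMeshedVariationFamily a b δx) :
    ∃ C : ℝ, ∀ᶠ h : ℝ in 𝓝[>] 0,
      |partsError a b (L h) (x h) (δx h) i| ≤ C * (h ^ (k + 1) * norm1 a b (δx h)) := by
  obtain ⟨h₁, hh₁, hpb⟩ := exists_bound_partialTower hab hL hx
  obtain ⟨C₁, hC₁⟩ := hi
  -- The `i` derivatives falling on `∂L/∂x^(i)` cost `i` powers of `h`, leaving `O(h^(k+1))` against
  -- `‖δx_h‖₁`.
  obtain ⟨C₂, hC₂⟩ := exists_bound_deriv_of_interior hab (p := k + i + 1) (j := i)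
    (f := fun h => partialTower a b (L h) (x h) i)
    (fun h hh => isTower_partialTower hab (hL.smooth h hh) (hx.smooth h hh) i)
    ⟨h₁, hh₁, fun m => hpb i m⟩ (by omega) (by
      refine ⟨C₁, ?_⟩
      filter_upwards [hC₁, self_mem_nhdsWithin] with h hh hpos t ht
      have hpos : 0 < h := hpos
      rw [partialTower_zero]
      exact hh t ⟨by linarith [ht.1], by linarith [ht.2]⟩)
  -- In the other integral the derivatives fall on `δx_h` and cost the same `i` powers.
  obtain ⟨K, hK⟩ := hδ.integral_norm_deriv_le hab i
  obtain ⟨h₂, hh₂, hbd⟩ := hδ.admissible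
  refine ⟨|C₁| * K + C₂, ?_⟩
  filter_upwards [hC₁, hC₂, hK, Ioc_mem_nhdsGT hh₂] with h h1 h2 h3 h4
  have hpos := h4.1
  have hy := hδ.meshed h hpos
  obtain ⟨t₀, hsm⟩ := hy.exists_mesh
  obtain ⟨Ci, hCi⟩ := hbd i
  have h5 := abs_integral_clm_le hab.le (A := partialTower a b (L h) (x h) i 0)
    (y := iteratedDeriv i (δx h)) (B := |C₁| * h ^ (k + i + 1))
    (Eventually.of_forall fun t ht => by
      rw [partialTower_zero]
      refine (h1 t (Ioc_subset_Icc_self ht)).trans ?_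
      exact mul_le_mul_of_nonneg_right (le_abs_self _) (by positivity))
    (intervalIntegrable_iteratedDeriv hab.le (countable_mesh t₀ h) hsm
      fun t h1 h2 => hCi h h4 t h1 (hsm t h2)).norm
  have h6 := abs_integral_clm_le hab.le (A := partialTower a b (L h) (x h) i i)
    (y := δx h) (B := C₂ * h ^ (k + 1))
    (Eventually.of_forall fun t ht => by
      have := h2 t (Ioc_subset_Icc_self ht)
      rwa [show k + i + 1 - i = k + 1 by omega] at this)
    (hy.continuous.norm.intervalIntegrable _ _)
  have h7 : |C₁| * h ^ (k + i + 1) * ∫ t in a..b, ‖iteratedDeriv i (δx h) t‖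
      ≤ |C₁| * K * (h ^ (k + 1) * norm1 a b (δx h)) := by
    calc _ = |C₁| * h ^ (k + 1) * (h ^ i * ∫ t in a..b, ‖iteratedDeriv i (δx h) t‖) := by ring
      _ ≤ |C₁| * h ^ (k + 1) * (K * norm1 a b (δx h)) :=
        mul_le_mul_of_nonneg_left h3 (by positivity)
      _ = _ := by ring
  rw [partsError]
  refine (abs_sub _ _).trans ?_
  rw [abs_mul, abs_pow, abs_neg, abs_one, one_pow, one_mul]
  have h8 : C₂ * h ^ (k + 1) * ∫ t in a..b, ‖δx h t‖ = C₂ * (h ^ (k + 1) * norm1 a b (δx h)) := by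
    rw [norm1]
    ring
  linarith

theorem isMeshedKCritical_of_uniformBigO {a b : ℝ} (hab : a < b) {L : ℝ → Jet N n → ℝ}
    (hL : IsLagrangianFamily L) {x : ℝ → ℝ → Conf N} (hx : IsAdmissible a b x) {k : ℕ}
    (hEL : UniformBigO a b (fun h => eulerLagrange a b (L h) (x h)) (k + 1))
    (hP : ∀ l : ℕ, 2 ≤ l →
      UniformBigO a b (fun h => partialAlong a b (L h) (x h) l) (k + l + 1)) :
    IsMeshedKCritical a b L k x := by
  intro δx hδ
  obtain ⟨C, hC⟩ := hEL
  obtain ⟨hmax, hmax0, hbd⟩ := hδ.admissible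
  have h1 : ∀ i, ∃ C : ℝ, ∀ᶠ h : ℝ in 𝓝[>] 0,
      |partsError a b (L h) (x h) (δx h) i| ≤ C * (h ^ (k + 1) * norm1 a b (δx h)) := by
    intro i
    rcases lt_or_ge i 2 with hi | hi
    · refine ⟨0, ?_⟩
      filter_upwards [Ioc_mem_nhdsGT hmax0] with h hh
      rw [(hδ.meshed h hh.1).partsError_eq_zero hab (hL.smooth h hh.1) (hx.smooth h hh.1)
        (fun j => (hbd j).imp fun C hC => hC h hh) hi]
      simp
    · exact exists_bound_partsError hab hL hx (hP i hi) hδ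
  choose c hc using h1
  have h2 : ∀ᶠ h : ℝ in 𝓝[>] 0, ∀ i ∈ Finset.range (n + 1),
      |partsError a b (L h) (x h) (δx h) i| ≤ c i * (h ^ (k + 1) * norm1 a b (δx h)) :=
    (Finset.eventually_all _).2 fun i _ => hc i
  refine IsBigO.of_bound (C + ∑ i ∈ Finset.range (n + 1), c i) ?_
  filter_upwards [h2, hC, Ioc_mem_nhdsGT hmax0] with h h3 h4 h5
  have hpos := h5.1
  have hy := hδ.meshed h hpos
  rw [hy.firstVariation_eq hab (hL.smooth h hpos) (hx.smooth h hpos)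
    (fun j => (hbd j).imp fun C hC => hC h h5), Real.norm_eq_abs, Real.norm_eq_abs,
    abs_of_nonneg (mul_nonneg (pow_nonneg hpos.le _) (norm1_nonneg hab.le _)), add_mul,
    Finset.sum_mul]
  refine (abs_add_le _ _).trans (add_le_add ?_
    ((Finset.abs_sum_le_sum_abs _ _).trans (Finset.sum_le_sum h3)))
  rw [elTower_zero, ← mul_assoc]
  exact abs_integral_clm_le hab.le
    (Eventually.of_forall fun t ht => h4 t (Ioc_subset_Icc_self ht))
    (hy.continuous.norm.intervalIntegrable _ _)

end MeshedSufficient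

/-! ### Rescaled polynomial test variations -/

section TestVariation

open MeasureTheory Polynomial

variable {N n : ℕ}

/-- The derivatives of the curve `t ↦ h^deg(P) P((t - s) / h) v`. -/
def polyTower (P : ℝ[X]) (h s : ℝ) (v : Conf N) (j : ℕ) (t : ℝ) : Conf N :=
  (h ^ P.natDegree * h⁻¹ ^ j * (derivative^[j] P).eval ((t - s) / h)) • v

/-- The test variation `h^deg(P) P((t - s) / h) v` on `[s, s + h]`, extended by its values at the
endpoints. -/
def testVariation (P : ℝ[X]) (h s : ℝ) (v : Conf N) (t : ℝ) : Conf N :=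
  polyTower P h s v 0 (max s (min t (s + h)))

theorem isTower_polyTower (P : ℝ[X]) (h s : ℝ) (v : Conf N) (S : Set ℝ) :
    IsTower S (polyTower P h s v) := by
  intro j t _
  have h1 : HasDerivAt (fun t : ℝ => (t - s) / h) h⁻¹ t := by
    simpa using ((hasDerivAt_id t).sub_const s).div_const h
  have h2 := (((derivative^[j] P).hasDerivAt ((t - s) / h)).comp t h1).const_mul
    (h ^ P.natDegree * h⁻¹ ^ j)
  have h3 := (h2.smul_const v).hasDerivWithinAt (s := S)
  have h4 : polyTower P h s v (j + 1) t = (h ^ P.natDegree * h⁻¹ ^ j *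
      ((derivative (derivative^[j] P)).eval ((t - s) / h) * h⁻¹)) • v := by
    rw [polyTower, pow_succ, Function.iterate_succ_apply']
    congr 1
    ring
  rw [h4]
  exact h3

theorem iteratedDeriv_polyTower (P : ℝ[X]) (h s : ℝ) (v : Conf N) (j : ℕ) (t : ℝ) :
    iteratedDeriv j (polyTower P h s v 0) t = polyTower P h s v j t := by
  rw [← iteratedDerivWithin_univ]
  exact (isTower_polyTower P h s v univ).iteratedDerivWithin_eq uniqueDiffOn_univ j (mem_univ t)

theorem contDiff_polyTower (P : ℝ[X]) (h s : ℝ) (v : Conf N) :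
    ContDiff ℝ ∞ (polyTower P h s v 0) :=
  contDiffOn_univ.1 ((isTower_polyTower P h s v univ).contDiffOn uniqueDiffOn_univ)

theorem iterate_derivative_eval_eq_zero {p P : ℝ[X]} {m r : ℕ} {c : ℝ} (hp : p.eval c = 0)
    (hP : p ^ m ∣ P) (hr : r < m) : (derivative^[r] P).eval c = 0 := by
  obtain ⟨q, hq⟩ := pow_sub_dvd_iterate_derivative_of_pow_dvd r hP
  rw [hq, eval_mul, eval_pow, hp, zero_pow (by omega), zero_mul]

variable {P : ℝ[X]} {h s : ℝ} {v : Conf N}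

theorem polyTower_left (j : ℕ) (h0 : (derivative^[j] P).eval 0 = 0) :
    polyTower P h s v j s = 0 := by
  simp [polyTower, h0]

theorem polyTower_right (hh : 0 < h) (j : ℕ) (h1 : (derivative^[j] P).eval 1 = 0) :
    polyTower P h s v j (s + h) = 0 := by
  have : (s + h - s) / h = 1 := by field_simp; ring
  rw [polyTower, this, h1, mul_zero, zero_smul]

theorem continuous_testVariation : Continuous (testVariation P h s v) := by
  have h1 : Continuous (polyTower P h s v 0) := (contDiff_polyTower P h s v).continuous
  exact h1.comp (by fun_prop)

theorem testVariation_of_mem {t : ℝ} (ht : t ∈ Icc s (s + h)) :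
    testVariation P h s v t = polyTower P h s v 0 t := by
  rw [testVariation, min_eq_left ht.2, max_eq_right ht.1]

theorem testVariation_of_notMem (hh : 0 < h) (h0 : P.eval 0 = 0) (h1 : P.eval 1 = 0) {t : ℝ}
    (ht : t ∉ Icc s (s + h)) : testVariation P h s v t = 0 := by
  rcases lt_or_ge t s with h2 | h2
  · rw [testVariation, min_eq_left (by linarith), max_eq_left h2.le]
    exact polyTower_left 0 h0
  · have h3 : s + h < t := by
      by_contra! h3
      exact ht ⟨h2, h3⟩
    rw [testVariation, min_eq_right h3.le, max_eq_right (by linarith)]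
    exact polyTower_right hh 0 h1

theorem testVariation_eventuallyEq_of_mem {t : ℝ} (ht : t ∈ Ioo s (s + h)) :
    testVariation P h s v =ᶠ[𝓝 t] polyTower P h s v 0 := by
  filter_upwards [Icc_mem_nhds ht.1 ht.2] with u hu
  exact testVariation_of_mem hu

theorem testVariation_eventuallyEq_of_notMem (hh : 0 < h) (h0 : P.eval 0 = 0)
    (h1 : P.eval 1 = 0) {t : ℝ} (ht : t ∉ Icc s (s + h)) :
    testVariation P h s v =ᶠ[𝓝 t] fun _ => 0 := by
  filter_upwards [isClosed_Icc.isOpen_compl.mem_nhds ht] with u hu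
  exact testVariation_of_notMem hh h0 h1 hu

theorem iteratedDeriv_testVariation_of_mem {t : ℝ} (ht : t ∈ Ioo s (s + h)) (j : ℕ) :
    iteratedDeriv j (testVariation P h s v) t = polyTower P h s v j t := by
  rw [((testVariation_eventuallyEq_of_mem ht).iteratedDeriv j).eq_of_nhds,
    iteratedDeriv_polyTower]

theorem iteratedDeriv_testVariation_of_notMem (hh : 0 < h) (h0 : P.eval 0 = 0)
    (h1 : P.eval 1 = 0) {t : ℝ} (ht : t ∉ Icc s (s + h)) (j : ℕ) :
    iteratedDeriv j (testVariation P h s v) t = 0 := by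
  rw [((testVariation_eventuallyEq_of_notMem hh h0 h1 ht).iteratedDeriv j).eq_of_nhds]
  simp

theorem contDiffAt_testVariation (hh : 0 < h) (h0 : P.eval 0 = 0) (h1 : P.eval 1 = 0) {t : ℝ}
    (hts : t ≠ s) (hts' : t ≠ s + h) : ContDiffAt ℝ ∞ (testVariation P h s v) t := by
  by_cases ht : t ∈ Icc s (s + h)
  · exact (contDiff_polyTower P h s v).contDiffAt.congr_of_eventuallyEq
      (testVariation_eventuallyEq_of_mem ⟨lt_of_le_of_ne ht.1 hts.symm, lt_of_le_of_ne ht.2 hts'⟩)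
  · exact contDiffAt_const.congr_of_eventuallyEq
      (testVariation_eventuallyEq_of_notMem hh h0 h1 ht)

theorem isMeshedVariation_testVariation {a b : ℝ} (hh : 0 < h) (h0 : P.eval 0 = 0)
    (h1 : P.eval 1 = 0) (has : a < s) (hsb : s + h < b) :
    IsMeshedVariation a b h (testVariation P h s v) where
  continuous := continuous_testVariation
  zero_outside t ht := testVariation_of_notMem hh h0 h1 fun h' =>
    ht ⟨by linarith [h'.1], by linarith [h'.2]⟩
  smooth_off_mesh := by
    refine ⟨s, ⟨has.le, by linarith⟩, fun t => ?_⟩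
    by_cases h2 : t = s
    · exact Or.inl ⟨⟨by linarith, by linarith⟩, 0, by simp [h2]⟩
    by_cases h3 : t = s + h
    · exact Or.inl ⟨⟨by linarith, by linarith⟩, 1, by simp [h3]⟩
    exact Or.inr (contDiffAt_testVariation hh h0 h1 h2 h3)

theorem isMeshedVariation_zero {a b : ℝ} (hab : a ≤ b) (h : ℝ) :
    IsMeshedVariation a b h (fun _ => (0 : Conf N)) :=
  ⟨continuous_const, fun _ _ => rfl, a, left_mem_Icc.2 hab, fun _ => Or.inr contDiffAt_const⟩

/-- The `j`-th derivative scales as `h^(deg P - j)`, which is at most `1` when `j ≤ deg P`, and it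
is zero for larger `j`. This is the purpose of the prefactor `h^(deg P)`. -/
theorem exists_bound_polyTower (P : ℝ[X]) (j : ℕ) : ∃ C : ℝ, 0 ≤ C ∧ ∀ (h s : ℝ) (v : Conf N),
    h ∈ Ioc 0 1 → ‖v‖ = 1 → ∀ t ∈ Icc s (s + h), ‖polyTower P h s v j t‖ ≤ C := by
  obtain ⟨C, hC⟩ := isCompact_Icc.exists_bound_of_continuousOn (s := Icc (0 : ℝ) 1)
    (derivative^[j] P).continuous.continuousOn
  refine ⟨C, (norm_nonneg _).trans (hC 0 (by simp)), fun h s v hh hv t ht => ?_⟩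
  have hC0 : 0 ≤ C := (norm_nonneg _).trans (hC 0 (by simp))
  have h1 : (t - s) / h ∈ Icc (0 : ℝ) 1 :=
    ⟨div_nonneg (by linarith [ht.1]) hh.1.le, (div_le_one hh.1).2 (by linarith [ht.2])⟩
  rw [polyTower, norm_smul, hv, mul_one, norm_mul]
  rcases lt_or_ge P.natDegree j with h2 | h2
  · rw [iterate_derivative_eq_zero h2]
    simpa using hC0
  · have h3 : h ^ P.natDegree * h⁻¹ ^ j = h ^ (P.natDegree - j) := by
      rw [pow_sub₀ _ hh.1.ne' h2, inv_pow]
    rw [h3, norm_pow, Real.norm_eq_abs, abs_of_pos hh.1]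
    exact (mul_le_of_le_one_left (norm_nonneg _) (pow_le_one₀ hh.1.le hh.2)).trans (hC _ h1)

theorem exists_bound_testVariation (h0 : P.eval 0 = 0) (h1 : P.eval 1 = 0) (j : ℕ) :
    ∃ C : ℝ, ∀ (h s : ℝ) (v : Conf N), h ∈ Ioc 0 1 → ‖v‖ = 1 → ∀ t : ℝ,
      ContDiffAt ℝ ∞ (testVariation P h s v) t →
        ‖iteratedDeriv j (testVariation P h s v) t‖ ≤ C := by
  obtain ⟨C, hC0, hC⟩ := exists_bound_polyTower (N := N) P j
  refine ⟨C, fun h s v hh hv t ht => ?_⟩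
  have hgen : ∀ t, t ≠ s → t ≠ s + h → ‖iteratedDeriv j (testVariation P h s v) t‖ ≤ C := by
    intro t h2 h3
    by_cases ht : t ∈ Icc s (s + h)
    · rw [iteratedDeriv_testVariation_of_mem
        ⟨lt_of_le_of_ne ht.1 h2.symm, lt_of_le_of_ne ht.2 h3⟩]
      exact hC h s v hh hv t ht
    · rw [iteratedDeriv_testVariation_of_notMem hh.1 h0 h1 ht, norm_zero]
      exact hC0
  have hc := (hasDerivAt_iteratedDeriv ht j).continuousAt.norm
  -- The function may happen to be smooth at a junction `s` or `s + h`; the bound there is the limit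
  -- of the bounds at nearby points.
  have hfin : ∀ᶠ u in 𝓝[≠] t, u ≠ s ∧ u ≠ s + h := by
    have h3 : ((({s, s + h} : Set ℝ) \ {t})ᶜ) ∈ 𝓝 t :=
      (((Set.toFinite ({s, s + h} : Set ℝ)).subset sdiff_subset).isClosed).isOpen_compl.mem_nhds
        (by simp)
    filter_upwards [nhdsWithin_le_nhds h3, self_mem_nhdsWithin] with u hu hut
    have hut : u ≠ t := hut
    constructor
    · rintro rfl
      exact hu ⟨by simp, hut⟩
    · rintro rfl
      exact hu ⟨by simp, hut⟩
  exact le_of_tendsto (hc.tendsto.mono_left nhdsWithin_le_nhds)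
    (hfin.mono fun u hu => hgen u hu.1 hu.2)

/-- An integrand supported in a subinterval. -/
theorem integral_eq_of_support {a b s s' : ℝ} (has : a ≤ s) (hss : s ≤ s') (hsb : s' ≤ b)
    {f g : ℝ → ℝ} (h0 : ∀ t, t ∉ Icc s s' → f t = 0) (h1 : ∀ t ∈ Ioo s s', f t = g t) :
    ∫ t in a..b, f t = ∫ t in s..s', g t := by
  rw [intervalIntegral.integral_of_le (by linarith), intervalIntegral.integral_of_le hss,
    ← integral_indicator measurableSet_Ioc, ← integral_indicator measurableSet_Ioc]
  refine integral_congr_ae ?_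
  filter_upwards [measure_eq_zero_iff_ae_notMem.1
    ((Set.toFinite ({s, s'} : Set ℝ)).measure_zero volume)] with t ht
  simp only [mem_insert_iff, mem_singleton_iff, not_or] at ht
  by_cases h2 : t ∈ Icc s s'
  · have h3 : t ∈ Ioo s s' := ⟨lt_of_le_of_ne h2.1 (Ne.symm ht.1), lt_of_le_of_ne h2.2 ht.2⟩
    rw [indicator_of_mem (Ioo_subset_Ioc_self h3),
      indicator_of_mem (show t ∈ Ioc a b from ⟨by linarith [h3.1], by linarith [h3.2]⟩), h1 t h3]
  · rw [indicator_of_notMem (fun h' => h2 (Ioc_subset_Icc_self h'))]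
    by_cases h3 : t ∈ Ioc a b
    · rw [indicator_of_mem h3, h0 t h2]
    · rw [indicator_of_notMem h3]

theorem integral_rescale (hh : 0 < h) (f : ℝ → ℝ) :
    ∫ t in s..s + h, f t = h * ∫ u in (0 : ℝ)..1, f (s + h * u) := by
  have h1 := intervalIntegral.integral_comp_mul_add (a := 0) (b := 1) f hh.ne' s
  simp only [mul_zero, zero_add, mul_one, smul_eq_mul] at h1
  simp_rw [add_comm s]
  rw [h1, ← mul_assoc, mul_inv_cancel₀ hh.ne', one_mul]

theorem norm1_testVariation {a b : ℝ} (hh : 0 < h) (h0 : P.eval 0 = 0) (h1 : P.eval 1 = 0)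
    (has : a < s) (hsb : s + h < b) (hv : ‖v‖ = 1) :
    norm1 a b (testVariation P h s v)
      = h ^ (P.natDegree + 1) * ∫ u in (0 : ℝ)..1, |P.eval u| := by
  rw [norm1, integral_eq_of_support (g := fun t => ‖polyTower P h s v 0 t‖) has.le
    (by linarith) hsb.le
    (fun t ht => by rw [testVariation_of_notMem hh h0 h1 ht, norm_zero])
    (fun t ht => by rw [testVariation_of_mem (Ioo_subset_Icc_self ht)]), integral_rescale hh]
  have : ∀ u : ℝ, ‖polyTower P h s v 0 (s + h * u)‖ = h ^ P.natDegree * |P.eval u| := by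
    intro u
    have h2 : (s + h * u - s) / h = u := by field_simp; ring
    rw [polyTower, norm_smul, hv, h2]
    simp [abs_of_pos hh]
  simp_rw [this]
  rw [intervalIntegral.integral_const_mul]
  ring

theorem integral_abs_eval_pos (hP : P ≠ 0) : 0 < ∫ u in (0 : ℝ)..1, |P.eval u| := by
  obtain ⟨u, hu, hne⟩ : ∃ u ∈ Icc (0 : ℝ) 1, P.eval u ≠ 0 := by
    by_contra! h'
    exact hP (eq_zero_of_infinite_isRoot _ ((Icc_infinite zero_lt_one).mono fun u hu => h' u hu))
  exact intervalIntegral.integral_pos zero_lt_one P.continuous.abs.continuousOn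
    (fun _ _ => abs_nonneg _) ⟨u, hu, abs_pos.2 hne⟩

/-- Meshed test variations that detect the maximum of a covector field over the interior. -/
theorem exists_test_family [Nontrivial (Conf N)] {a b : ℝ} (hab : a < b) (hP : P ≠ 0)
    (h0 : P.eval 0 = 0) (h1 : P.eval 1 = 0) {A : ℝ → ℝ → Conf N →L[ℝ] ℝ}
    (hA : ∀ h : ℝ, 0 < h → ContinuousOn (A h) (Icc a b)) :
    ∃ (s : ℝ → ℝ) (v : ℝ → Conf N) (δx : ℝ → ℝ → Conf N), IsMeshedVariationFamily a b δx ∧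
      ∀ᶠ h : ℝ in 𝓝[>] 0, h ∈ Ioc 0 1 ∧ a < s h ∧ s h + h < b ∧ ‖v h‖ = 1 ∧
        A h (s h) (v h) = ‖A h (s h)‖ ∧
        (∀ t ∈ Icc (a + 2 * h) (b - 2 * h), ‖A h t‖ ≤ ‖A h (s h)‖) ∧
        δx h = testVariation P h (s h) (v h) := by
  classical
  -- Maximizing at distance `2h` from the ends keeps `[s, s + h]` inside `(a, b)`; `h ≤ (b - a) / 4`
  -- makes the interval nonempty.
  have hmax : ∀ h : ℝ, ∃ s, 0 < h → h ≤ (b - a) / 4 → s ∈ Icc (a + 2 * h) (b - 2 * h) ∧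
      ∀ t ∈ Icc (a + 2 * h) (b - 2 * h), ‖A h t‖ ≤ ‖A h s‖ := by
    intro h
    by_cases hh : 0 < h ∧ h ≤ (b - a) / 4
    · obtain ⟨s, hs, hm⟩ := isCompact_Icc.exists_isMaxOn
        (nonempty_Icc.2 (show a + 2 * h ≤ b - 2 * h by linarith [hh.2]))
        ((hA h hh.1).mono (Icc_subset_Icc (by linarith [hh.1]) (by linarith [hh.1]))).norm
      exact ⟨s, fun _ _ => ⟨hs, fun t ht => hm ht⟩⟩
    · exact ⟨0, fun h' h'' => absurd ⟨h', h''⟩ hh⟩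
  choose s hs using hmax
  choose v hv using fun h => exists_norm_eq_one_apply_eq_norm (A h (s h))
  -- A family must be meshed for every `h > 0`, so the zero variation fills in for large `h`.
  set δx : ℝ → ℝ → Conf N := fun h =>
    if h ≤ (b - a) / 4 then testVariation P h (s h) (v h) else fun _ => 0 with hδx
  have hb : 0 < (b - a) / 4 := by linarith
  have hev : ∀ᶠ h : ℝ in 𝓝[>] 0, h ∈ Ioc 0 1 ∧ a < s h ∧ s h + h < b ∧
      δx h = testVariation P h (s h) (v h) := by
    filter_upwards [Ioc_mem_nhdsGT (zero_lt_one' ℝ), Ioc_mem_nhdsGT hb] with h h2 h3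
    obtain ⟨hm, -⟩ := hs h h2.1 h3.2
    exact ⟨h2, by linarith [hm.1, h2.1], by linarith [hm.2, h2.1], if_pos h3.2⟩
  refine ⟨s, v, δx, ⟨fun h hh => ?_, ⟨1, one_pos, fun m => ?_⟩, P.natDegree + 1, ?_⟩, ?_⟩
  · simp only [hδx]
    split_ifs with h2
    · obtain ⟨hm, -⟩ := hs h hh h2
      exact isMeshedVariation_testVariation hh h0 h1 (by linarith [hm.1]) (by linarith [hm.2])
    · exact isMeshedVariation_zero hab.le h
  · obtain ⟨C, hC⟩ := exists_bound_testVariation (N := N) h0 h1 m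
    refine ⟨max C 0, fun h hh t _ => ?_⟩
    simp only [hδx]
    split_ifs with h2
    · exact fun h3 => (hC h _ _ hh (hv h).1 t h3).trans (le_max_left _ _)
    · intro _
      simp
  · have hc := integral_abs_eval_pos hP
    refine IsBigO.of_bound (∫ u in (0 : ℝ)..1, |P.eval u|)⁻¹ ?_
    filter_upwards [hev] with h h2
    rw [h2.2.2.2, norm1_testVariation h2.1.1 h0 h1 h2.2.1 h2.2.2.1 (hv h).1, norm_mul,
      Real.norm_eq_abs (∫ u in (0 : ℝ)..1, |P.eval u|), abs_of_pos hc]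
    field_simp
    exact le_rfl
  · filter_upwards [hev, Ioc_mem_nhdsGT hb] with h h2 h3
    exact ⟨h2.1, h2.2.1, h2.2.2.1, (hv h).1, (hv h).2, (hs h h3.1 h3.2).2, h2.2.2.2⟩

end TestVariation

/-! ### Part (b): necessity -/

section MeshedNecessary

open MeasureTheory Polynomial

variable {N n : ℕ}

section

variable {a b : ℝ} {L : Jet N n → ℝ} {x : ℝ → Conf N} {P : ℝ[X]} {h s : ℝ} {v : Conf N}

theorem integral_clm_testVariation (hh : 0 < h) (h0 : P.eval 0 = 0) (h1 : P.eval 1 = 0)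
    (has : a < s) (hsb : s + h < b) (A : ℝ → Conf N →L[ℝ] ℝ) (i : ℕ) :
    ∫ t in a..b, A t (iteratedDeriv i (testVariation P h s v) t)
      = ∫ t in s..s + h, A t (polyTower P h s v i t) :=
  integral_eq_of_support has.le (by linarith) hsb.le
    (fun t ht => by rw [iteratedDeriv_testVariation_of_notMem hh h0 h1 ht, map_zero])
    (fun t ht => by rw [iteratedDeriv_testVariation_of_mem ht])

theorem partsError_testVariation (hh : 0 < h) (h0 : P.eval 0 = 0) (h1 : P.eval 1 = 0)
    (has : a < s) (hsb : s + h < b) (i : ℕ) :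
    partsError a b L x (testVariation P h s v) i
      = (∫ t in s..s + h, partialTower a b L x i 0 t (polyTower P h s v i t))
        - (-1) ^ i * ∫ t in s..s + h, partialTower a b L x i i t (polyTower P h s v 0 t) := by
  rw [partsError, integral_clm_testVariation hh h0 h1 has hsb]
  have := integral_clm_testVariation (v := v) hh h0 h1 has hsb (partialTower a b L x i i) 0
  rw [iteratedDeriv_zero] at this
  rw [this]

theorem partsError_testVariation_eq_zero (hL : ContDiff ℝ ∞ L) (hx : ContDiffOn ℝ ∞ x (Icc a b))
    (hh : 0 < h) (h0 : P.eval 0 = 0) (h1 : P.eval 1 = 0)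
    (has : a < s) (hsb : s + h < b) {i : ℕ}
    (hP : ∀ r < i, (derivative^[r] P).eval 0 = 0 ∧ (derivative^[r] P).eval 1 = 0) :
    partsError a b L x (testVariation P h s v) i = 0 := by
  have hsub : Icc s (s + h) ⊆ Icc a b := Icc_subset_Icc has.le hsb.le
  rw [partsError_testVariation hh h0 h1 has hsb,
    ((isTower_partialTower (by linarith) hL hx i).mono hsub).integral_clm_iterate (by linarith)
      (isTower_polyTower P h s v _) i 0
      fun r hr => ⟨polyTower_left r (hP r hr).1, polyTower_right hh r (hP r hr).2⟩]
  simp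

/-- The kink at `s` is the only source of error at order `i + 1`, and it exposes `∂L/∂x^(i+1)` at
that point. -/
theorem partsError_testVariation_succ (hL : ContDiff ℝ ∞ L) (hx : ContDiffOn ℝ ∞ x (Icc a b))
    (hh : 0 < h) (h0 : P.eval 0 = 0) (h1 : P.eval 1 = 0)
    (has : a < s) (hsb : s + h < b) {i : ℕ}
    (hP : ∀ r < i, (derivative^[r] P).eval 0 = 0 ∧ (derivative^[r] P).eval 1 = 0)
    (hP' : (derivative^[i] P).eval 1 = 0) :
    partsError a b L x (testVariation P h s v) (i + 1)
      = -partialTower a b L x (i + 1) 0 s (polyTower P h s v i s) := by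
  have hsub : Icc s (s + h) ⊆ Icc a b := Icc_subset_Icc has.le hsb.le
  rw [partsError_testVariation hh h0 h1 has hsb,
    ((isTower_partialTower (by linarith) hL hx (i + 1)).mono hsub).integral_clm_iterate_boundary
      (by linarith) (isTower_polyTower P h s v _) i 0
      (fun r hr => ⟨polyTower_left r (hP r hr).1, polyTower_right hh r (hP r hr).2⟩)
      (polyTower_right hh i hP')]
  simp

end

theorem exists_bound_firstVariation {a b : ℝ} {L : ℝ → Jet N n → ℝ} {x : ℝ → ℝ → Conf N} {k : ℕ}
    (hab : a < b) (hcrit : IsMeshedKCritical a b L k x) {δx : ℝ → ℝ → Conf N}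
    (hδ : IsMeshedVariationFamily a b δx) :
    ∃ C : ℝ, 0 ≤ C ∧ ∀ᶠ h : ℝ in 𝓝[>] 0, |firstVariation a b (L h) (x h) (δx h)|
      ≤ C * (h ^ (k + 1) * norm1 a b (δx h)) := by
  obtain ⟨C, hC0, hC⟩ := (hcrit δx hδ).exists_nonneg
  refine ⟨C, hC0, ?_⟩
  filter_upwards [hC.bound, self_mem_nhdsWithin] with h h1 h2
  have h2 : 0 < h := h2
  rwa [Real.norm_eq_abs, Real.norm_eq_abs,
    abs_of_nonneg (mul_nonneg (pow_nonneg h2.le _) (norm1_nonneg hab.le _))] at h1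

theorem exists_bound_family_deriv {a b : ℝ} {δx : ℝ → ℝ → Conf N}
    (hδ : IsMeshedVariationFamily a b δx) : ∀ᶠ h : ℝ in 𝓝[>] 0, ∀ j, ∃ C, ∀ t ∈ Icc a b,
      ContDiffAt ℝ ∞ (δx h) t → ‖iteratedDeriv j (δx h) t‖ ≤ C := by
  obtain ⟨hmax, hmax0, hbd⟩ := hδ.admissible
  filter_upwards [Ioc_mem_nhdsGT hmax0] with h hh j
  exact (hbd j).imp fun C hC => hC h hh

/-- On a test function of width `h`, freezing the Euler-Lagrange expression would leave an error
`O(h)`. The reproducing density `W` lowers it to `O(h^(k+1))`, and its zeros of order `n + 1` at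
both ends remove every `partsError`. -/
theorem uniformBigO_eulerLagrange_of_isMeshedKCritical [Nontrivial (Conf N)] {a b : ℝ}
    (hab : a < b) {L : ℝ → Jet N n → ℝ} (hL : IsLagrangianFamily L) {x : ℝ → ℝ → Conf N}
    (hx : IsAdmissible a b x) {k : ℕ} (hcrit : IsMeshedKCritical a b L k x) :
    UniformBigO a b (fun h => eulerLagrange a b (L h) (x h)) (k + 1) := by
  obtain ⟨W, ⟨W', hW'⟩, K, hK, hker⟩ := exists_density_deriv le_rfl (zero_lt_one' ℝ) le_rfl (n + 1)
    (k + 1) (j := 0) (by omega)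
  have hd0 : (X - C 0 : ℝ[X]) ^ (n + 1) ∣ W := ⟨_, hW'.trans (mul_assoc _ _ _)⟩
  have hd1 : (C 1 - X : ℝ[X]) ^ (n + 1) ∣ W := ⟨(X - C 0) ^ (n + 1) * W', hW'.trans (by ring)⟩
  have hv0 : ∀ r < n + 1, (derivative^[r] W).eval 0 = 0 := fun r hr =>
    iterate_derivative_eval_eq_zero (by simp) hd0 hr
  have hv1 : ∀ r < n + 1, (derivative^[r] W).eval 1 = 0 := fun r hr =>
    iterate_derivative_eval_eq_zero (by simp) hd1 hr
  have h0 : W.eval 0 = 0 := hv0 0 (by omega)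
  have h1 : W.eval 1 = 0 := hv1 0 (by omega)
  -- Otherwise the reproducing estimate, applied to the constant `1` with `B = 0`, would give `1 ≤
  -- 0`.
  have hW0 : W ≠ 0 := by
    rintro rfl
    have := hker ℝ (fun j _ => if j = 0 then 1 else 0) (fun j t _ => by
      simpa using hasDerivWithinAt_const t (Icc (0 : ℝ) 1) (if j = 0 then (1 : ℝ) else 0)) 0
      (by simp)
    norm_num at this
  obtain ⟨s, v, δx, hδ, hev⟩ := exists_test_family hab hW0 h0 h1
    (A := fun h => elTower a b (L h) (x h) 0)
    (fun h hh => (isTower_elTower hab (hL.smooth h hh) (hx.smooth h hh)).continuousOn 0)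
  obtain ⟨c, hc0, hc⟩ := exists_bound_firstVariation hab hcrit hδ
  obtain ⟨hmax, hmax0, hbd⟩ := exists_bound_elTower hab hL hx
  obtain ⟨B, hB⟩ := hbd (k + 1)
  set I := ∫ u in (0 : ℝ)..1, |W.eval u| with hI
  have hmain : ∃ C : ℝ, ∀ᶠ h : ℝ in 𝓝[>] 0, ∀ t ∈ Icc (a + 2 * h) (b - 2 * h),
      ‖elTower a b (L h) (x h) 0 t‖ ≤ C * h ^ (k + 1) := by
    refine ⟨c * I + K * B, ?_⟩
    filter_upwards [hev, hc, Ioc_mem_nhdsGT hmax0, exists_bound_family_deriv hδ]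
      with h ⟨hh1, has, hsb, hvn, hAv, hmx, hδh⟩ h3 h4 h5 t ht
    have hpos := hh1.1
    refine (hmx t ht).trans ?_
    have hLs := hL.smooth h hpos
    have hxs := hx.smooth h hpos
    have hT := isTower_elTower hab hLs hxs
    rw [(hδ.meshed h hpos).firstVariation_eq hab hLs hxs h5, hδh,
      norm1_testVariation hpos h0 h1 has hsb hvn, Finset.sum_eq_zero (fun i hi =>
        partsError_testVariation_eq_zero hLs hxs hpos h0 h1 has hsb fun r hr =>
          have hr' : r < n + 1 := hr.trans (Finset.mem_range.1 hi)
          ⟨hv0 r hr', hv1 r hr'⟩), add_zero] at h3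
    have hmaps : MapsTo (fun u => s h + h * u) (Icc 0 1) (Icc a b) := by
      intro u hu
      have := mul_le_mul_of_nonneg_left hu.2 hpos.le
      have := mul_nonneg hpos.le hu.1
      exact ⟨by linarith, by linarith⟩
    have hg := (hT.clm_comp (ContinuousLinearMap.apply ℝ ℝ (v h))).comp_affine h (s h) hmaps
    have h6 := hker ℝ _ hg (B * h ^ (k + 1)) (fun u hu => by
      rw [norm_smul, norm_pow, Real.norm_eq_abs, abs_of_pos hpos, mul_comm]
      refine mul_le_mul_of_nonneg_right ?_ (by positivity)
      refine ((elTower a b (L h) (x h) (k + 1) (s h + h * u)).le_opNorm (v h)).trans ?_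
      rw [hvn, mul_one]
      exact hB h h4 _ (hmaps hu))
    simp only [pow_zero, one_mul, mul_zero, add_zero, ContinuousLinearMap.apply_apply, hAv,
      smul_eq_mul, Real.norm_eq_abs] at h6
    have h7 : ∫ t in a..b, elTower a b (L h) (x h) 0 t (testVariation W h (s h) (v h) t)
        = h ^ (W.natDegree + 1) *
          ∫ u in (0 : ℝ)..1, W.eval u * elTower a b (L h) (x h) 0 (s h + h * u) (v h) := by
      have h8 := integral_clm_testVariation (v := v h) hpos h0 h1 has hsb
        (elTower a b (L h) (x h) 0) 0
      rw [iteratedDeriv_zero] at h8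
      rw [h8, integral_rescale hpos, pow_succ', mul_assoc,
        ← intervalIntegral.integral_const_mul (h ^ W.natDegree)]
      congr 1
      refine intervalIntegral.integral_congr fun u _ => ?_
      have h9 : (s h + h * u - s h) / h = u := by field_simp; ring
      simp only [polyTower, h9, pow_zero, mul_one, Function.iterate_zero, id_eq, map_smul,
        smul_eq_mul, mul_assoc]
    rw [h7, abs_mul, abs_of_pos (pow_pos hpos _)] at h3
    have h10 : |∫ u in (0 : ℝ)..1, W.eval u * elTower a b (L h) (x h) 0 (s h + h * u) (v h)|
        ≤ c * I * h ^ (k + 1) := by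
      refine le_of_mul_le_mul_left (h3.trans_eq ?_) (pow_pos hpos (W.natDegree + 1))
      ring
    have h11 := abs_sub_abs_le_abs_sub ‖elTower a b (L h) (x h) 0 (s h)‖
      (∫ u in (0 : ℝ)..1, W.eval u * elTower a b (L h) (x h) 0 (s h + h * u) (v h))
    rw [abs_norm] at h11
    linarith
  have := exists_bound_deriv_of_interior hab (f := fun h => elTower a b (L h) (x h))
    (fun h hh => isTower_elTower hab (hL.smooth h hh) (hx.smooth h hh)) ⟨hmax, hmax0, hbd⟩
    (Nat.zero_le _) hmain
  simpa only [UniformBigO, elTower_zero, Nat.sub_zero] using this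

/-- This is the descending step: by `hP` the errors of order above `i + 1` are small, so criticality
bounds the one boundary term of order `i + 1`. -/
theorem uniformBigO_partialAlong_of_isMeshedKCritical [Nontrivial (Conf N)] {a b : ℝ}
    (hab : a < b) {L : ℝ → Jet N n → ℝ} (hL : IsLagrangianFamily L) {x : ℝ → ℝ → Conf N}
    (hx : IsAdmissible a b x) {k : ℕ} (hcrit : IsMeshedKCritical a b L k x) {i : ℕ} (hi : 1 ≤ i)
    (hin : i < n)
    (hP : ∀ l : ℕ, i + 1 < l →
      UniformBigO a b (fun h => partialAlong a b (L h) (x h) l) (k + l + 1)) :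
    UniformBigO a b (fun h => partialAlong a b (L h) (x h) (i + 1)) (k + (i + 1) + 1) := by
  obtain ⟨C₀, hC₀⟩ := uniformBigO_eulerLagrange_of_isMeshedKCritical hab hL hx hcrit
  -- The extra zero at `1` makes the `i`-th derivative nonzero only at the left end, where it equals
  -- `i!`.
  set P : ℝ[X] := X ^ i * (C 1 - X) ^ (i + 1) with hPdef
  have hv0 : ∀ r < i, (derivative^[r] P).eval 0 = 0 := fun r hr =>
    iterate_derivative_eval_eq_zero (p := X) (by simp) (dvd_mul_right _ _) hr
  have hv1 : ∀ r < i + 1, (derivative^[r] P).eval 1 = 0 := fun r hr =>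
    iterate_derivative_eval_eq_zero (p := C 1 - X) (by simp) (dvd_mul_left _ _) hr
  have h0 : P.eval 0 = 0 := hv0 0 (by omega)
  have h1 : P.eval 1 = 0 := hv1 0 (by omega)
  have hcoeff : P.coeff i = 1 := by
    have := coeff_X_pow_mul ((C 1 - X : ℝ[X]) ^ (i + 1)) i 0
    rw [zero_add] at this
    rw [hPdef, this, coeff_zero_eq_eval_zero]
    simp
  have hP0 : P ≠ 0 := by
    intro h'
    rw [h'] at hcoeff
    simp at hcoeff
  have hPi : (derivative^[i] P).eval 0 = i.factorial := by
    rw [← coeff_zero_eq_eval_zero, coeff_iterate_derivative, zero_add, hcoeff,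
      Nat.descFactorial_self]
    simp
  obtain ⟨s, v, δx, hδ, hev⟩ := exists_test_family hab hP0 h0 h1
    (A := fun h => partialTower a b (L h) (x h) (i + 1) 0)
    (fun h hh => (isTower_partialTower hab (hL.smooth h hh) (hx.smooth h hh) (i + 1)).continuousOn 0)
  obtain ⟨c, hc0, hc⟩ := exists_bound_firstVariation hab hcrit hδ
  obtain ⟨hmax, hmax0, hbd⟩ := exists_bound_partialTower hab hL hx
  have herr : ∀ l, ∃ C : ℝ, i + 1 < l → ∀ᶠ h : ℝ in 𝓝[>] 0,
      |partsError a b (L h) (x h) (δx h) l| ≤ C * (h ^ (k + 1) * norm1 a b (δx h)) := by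
    intro l
    by_cases hl : i + 1 < l
    · obtain ⟨C, hC⟩ := exists_bound_partsError hab hL hx (hP l hl) hδ
      exact ⟨C, fun _ => hC⟩
    · exact ⟨0, fun h' => absurd h' hl⟩
  choose e he using herr
  have he' : ∀ᶠ h : ℝ in 𝓝[>] 0, ∀ l ∈ (Finset.range (n + 1)).filter (i + 1 < ·),
      |partsError a b (L h) (x h) (δx h) l| ≤ e l * (h ^ (k + 1) * norm1 a b (δx h)) :=
    (Finset.eventually_all _).2 fun l hl => he l (Finset.mem_filter.1 hl).2
  set I := ∫ u in (0 : ℝ)..1, |P.eval u| with hI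
  set T := ∑ l ∈ (Finset.range (n + 1)).filter (i + 1 < ·), e l with hT
  have hmain : ∃ C : ℝ, ∀ᶠ h : ℝ in 𝓝[>] 0, ∀ t ∈ Icc (a + 2 * h) (b - 2 * h),
      ‖partialTower a b (L h) (x h) (i + 1) 0 t‖ ≤ C * h ^ (k + (i + 1) + 1) := by
    refine ⟨(c + C₀ + T) * I / i.factorial, ?_⟩
    filter_upwards [hev, hc, he', hC₀, exists_bound_family_deriv hδ]
      with h ⟨hh1, has, hsb, hvn, hAv, hmx, hδh⟩ h3 h4 hEL h5 t ht
    have hpos := hh1.1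
    refine (hmx t ht).trans ?_
    have hLs := hL.smooth h hpos
    have hxs := hx.smooth h hpos
    have hy := hδ.meshed h hpos
    set S := ∑ l ∈ (Finset.range (n + 1)).filter (i + 1 < ·), partsError a b (L h) (x h) (δx h) l
      with hS
    have hsum : ∑ l ∈ Finset.range (n + 1), partsError a b (L h) (x h) (δx h) l
        = partsError a b (L h) (x h) (δx h) (i + 1) + S := by
      rw [← Finset.sum_filter_add_sum_filter_not _ (i + 1 < ·), ← hS, add_comm]
      congr 1
      rw [Finset.sum_eq_single (i + 1)]
      · intro l hl hne
        have hl' : l < i + 1 := lt_of_le_of_ne (not_lt.1 (Finset.mem_filter.1 hl).2) hne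
        rw [hδh]
        exact partsError_testVariation_eq_zero hLs hxs hpos h0 h1 has hsb fun r hr =>
          ⟨hv0 r (by omega), hv1 r (by omega)⟩
      · intro h'
        exact absurd (Finset.mem_filter.2 ⟨Finset.mem_range.2 (by omega), lt_irrefl _⟩) h'
    have hSb : |S| ≤ T * (h ^ (k + 1) * norm1 a b (δx h)) := by
      rw [hT, Finset.sum_mul]
      exact (Finset.abs_sum_le_sum_abs _ _).trans (Finset.sum_le_sum h4)
    have hELb : |∫ t in a..b, elTower a b (L h) (x h) 0 t (δx h t)|
        ≤ C₀ * (h ^ (k + 1) * norm1 a b (δx h)) := by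
      rw [elTower_zero, ← mul_assoc]
      exact abs_integral_clm_le hab.le
        (Eventually.of_forall fun t ht => hEL t (Ioc_subset_Icc_self ht))
        (hy.continuous.norm.intervalIntegrable _ _)
    rw [hy.firstVariation_eq hab hLs hxs h5, hsum] at h3
    have hbnd : partsError a b (L h) (x h) (δx h) (i + 1)
        = -(h ^ P.natDegree * h⁻¹ ^ i * i.factorial
          * ‖partialTower a b (L h) (x h) (i + 1) 0 (s h)‖) := by
      rw [hδh, partsError_testVariation_succ hLs hxs hpos h0 h1 has hsb
        (fun r hr => ⟨hv0 r hr, hv1 r (by omega)⟩) (hv1 i (by omega)), polyTower, sub_self,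
        zero_div, hPi, map_smul, hAv, smul_eq_mul]
    have hnorm : norm1 a b (δx h) = h ^ (P.natDegree + 1) * I := by
      rw [hδh, norm1_testVariation hpos h0 h1 has hsb hvn]
    rw [hbnd] at h3
    rw [hnorm] at h3 hSb hELb
    set Q := ‖partialTower a b (L h) (x h) (i + 1) 0 (s h)‖
    set Y := ∫ t in a..b, elTower a b (L h) (x h) 0 t (δx h t)
    have h6 : h ^ P.natDegree * h⁻¹ ^ i * i.factorial * Q
        ≤ (c + C₀ + T) * (h ^ (k + 1) * (h ^ (P.natDegree + 1) * I)) := by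
      have e1 := abs_le.1 h3
      have e2 := abs_le.1 hSb
      have e3 := abs_le.1 hELb
      linarith [e1.1, e2.2, e3.2]
    -- The boundary term carries `h^(deg P - i)` and the norm `h^(deg P + 1)`; the quotient yields
    -- the `i + 1` additional powers of `h`.
    have hfac : (0 : ℝ) < i.factorial := by positivity
    have h7 : 0 < h ^ P.natDegree * h⁻¹ ^ i * i.factorial := by positivity
    refine le_of_mul_le_mul_left (h6.trans_eq ?_) h7
    have h8 : h⁻¹ ^ i * h ^ (k + (i + 1) + 1) = h ^ (k + 1) * h := by
      rw [show k + (i + 1) + 1 = i + (k + 1 + 1) by ring, pow_add, ← mul_assoc, ← mul_pow,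
        inv_mul_cancel₀ hpos.ne', one_pow, one_mul, pow_succ]
    calc _ = (c + C₀ + T) * I * h ^ P.natDegree * (h ^ (k + 1) * h) := by ring
      _ = (c + C₀ + T) * I * h ^ P.natDegree * (h⁻¹ ^ i * h ^ (k + (i + 1) + 1)) := by rw [h8]
      _ = _ := by field_simp
  have := exists_bound_deriv_of_interior hab (f := fun h => partialTower a b (L h) (x h) (i + 1))
    (fun h hh => isTower_partialTower hab (hL.smooth h hh) (hx.smooth h hh) (i + 1))
    ⟨hmax, hmax0, hbd (i + 1)⟩ (Nat.zero_le _) hmain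
  simpa only [UniformBigO, partialTower_zero, Nat.sub_zero] using this

theorem uniformBigO_partialAlong_of_lt {a b : ℝ} (L : ℝ → Jet N n → ℝ) (x : ℝ → ℝ → Conf N)
    {l : ℕ} (hl : n < l) (p : ℕ) :
    UniformBigO a b (fun h => partialAlong a b (L h) (x h) l) p := by
  refine ⟨0, Eventually.of_forall fun h t _ => ?_⟩
  have : ¬ l < n + 1 := by omega
  simp [partialAlong, partialL, this]

theorem isMeshedKCritical_iff {a b : ℝ} (hab : a < b) {L : ℝ → Jet N n → ℝ}
    (hL : IsLagrangianFamily L) {x : ℝ → ℝ → Conf N} (hx : IsAdmissible a b x) (k : ℕ) :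
    IsMeshedKCritical a b L k x ↔
      UniformBigO a b (fun h => eulerLagrange a b (L h) (x h)) (k + 1) ∧
      ∀ l : ℕ, 2 ≤ l →
        UniformBigO a b (fun h => partialAlong a b (L h) (x h) l) (k + l + 1) := by
  refine ⟨fun hcrit => ?_, fun H => isMeshedKCritical_of_uniformBigO hab hL hx H.1 H.2⟩
  rcases subsingleton_or_nontrivial (Conf N) with hN | hN
  · exact ⟨uniformBigO_of_subsingleton _ _ _ _, fun l _ => uniformBigO_of_subsingleton _ _ _ _⟩
  refine ⟨uniformBigO_eulerLagrange_of_isMeshedKCritical hab hL hx hcrit, ?_⟩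
  -- Descending induction on `l`, with `d` measuring how far it has come down from above `n`, where
  -- the partial derivatives are zero.
  have key : ∀ d l : ℕ, 2 ≤ l → n < l + d →
      UniformBigO a b (fun h => partialAlong a b (L h) (x h) l) (k + l + 1) := by
    intro d
    induction d with
    | zero => exact fun l _ hl => uniformBigO_partialAlong_of_lt L x hl _
    | succ d ih =>
      intro l hl hd
      rcases lt_or_ge n l with hnl | hnl
      · exact uniformBigO_partialAlong_of_lt L x hnl _
      obtain ⟨i, rfl⟩ : ∃ i, l = i + 1 := ⟨l - 1, by omega⟩
      exact uniformBigO_partialAlong_of_isMeshedKCritical hab hL hx hcrit (by omega) (by omega)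
        fun l' hl' => ih l' (by omega) (by omega)
  exact fun l hl => key (n + 1) l hl (by omega)

theorem isKCritical_iff {a b : ℝ} (hab : a < b) {L : ℝ → Jet N n → ℝ}
    (hL : IsLagrangianFamily L) {x : ℝ → ℝ → Conf N} (hx : IsAdmissible a b x) (k : ℕ) :
    IsKCritical a b L k x ↔
      UniformBigO a b (fun h => eulerLagrange a b (L h) (x h)) (k + 1) := by
  refine ⟨fun hcrit => ?_, isKCritical_of_uniformBigO hab hL hx⟩
  rcases subsingleton_or_nontrivial (Conf N) with hN | hN
  · exact uniformBigO_of_subsingleton _ _ _ _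
  · exact uniformBigO_of_isKCritical hab hL hx hcrit

end MeshedNecessary

end KCrit

end

theorem mainTheorem7 (N k : ℕ) :
    -- (a)
    (∀ (a b : ℝ), a < b → ∀ (n : ℕ) (L : ℝ → KCrit.Jet N n → ℝ), KCrit.IsLagrangianFamily L →
      ∀ x : ℝ → ℝ → KCrit.Conf N, KCrit.IsAdmissible a b x →
        (KCrit.IsKCritical a b L k x ↔
          KCrit.UniformBigO a b (fun h => KCrit.eulerLagrange a b (L h) (x h)) (k + 1))) ∧
    -- (b)
    (∀ (a b : ℝ), a < b → ∀ (n : ℕ) (L : ℝ → KCrit.Jet N n → ℝ), KCrit.IsLagrangianFamily L →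
      ∀ x : ℝ → ℝ → KCrit.Conf N, KCrit.IsAdmissible a b x →
        (KCrit.IsMeshedKCritical a b L k x ↔
          KCrit.UniformBigO a b (fun h => KCrit.eulerLagrange a b (L h) (x h)) (k + 1) ∧
          ∀ l : ℕ, 2 ≤ l →
            KCrit.UniformBigO a b (fun h => KCrit.partialAlong a b (L h) (x h) l) (k + l + 1))) ∧
    -- (c)
    (∀ L : KCrit.Conf N → KCrit.Conf N → ℝ → ℝ,
      (∀ h : ℝ, 0 < h → Differentiable ℝ
        (fun p : KCrit.Conf N × KCrit.Conf N => L p.1 p.2 h)) →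
      ∀ (n : ℝ → ℕ) (x : ℝ → ℕ → KCrit.Conf N),
        (KCrit.IsDiscKCritical L k n x ↔
          ∃ C : ℝ, ∀ᶠ h : ℝ in 𝓝[>] 0, ∀ j : ℕ, 1 ≤ j → j < n h →
            ‖KCrit.discEulerLagrange L h (x h (j - 1)) (x h j) (x h (j + 1))‖
              ≤ C * h ^ (k + 1))) := by
  exact ⟨fun a b hab n L hL x hx => KCrit.isKCritical_iff hab hL hx k,
    fun a b hab n L hL x hx => KCrit.isMeshedKCritical_iff hab hL hx k,
    fun L hL n x => KCrit.isDiscKCritical_iff hL n x k⟩
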